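/- **Setting.** Fix an integer $n\ge 1$, let $\mathbb T=\mathbb R/\mathbb Z$, and let $$v_1=(n,-1,\dots,-1),\dots,v_n=(-1,\dots,-1,n),\ v_{n+1}=(-1,\dots,-1),\qquad u_1=(1,0,\dots,0),\dots,u_n=(0,\dots,0,1),\ u_{n+1}=(-1,\dots,-1)$$ be the vertices of the polytope $\Delta_n$ of $\mathbb{CP}^n$ and of its dual $\Delta_n^*$. Let $f,f_*:\mathbb T^{n+1}\to\mathbb T^n$ be induced by $x\mapsto\sum_j x_ju_j$ and $x\mapsto\sum_j x_jv_j$, let $f^t,f_*^t:\mathbb T^n\to\mathbb T^{n+1}$ be induced by the transposed matrices, and put $N=\ker f$, $N_*=\ker f_*$, $D=N\cap \operatorname{Im} f_*^t$, $D_*=N_*\cap\operatorname{Im} f^t$ (the last two groups are finite). For real $k_1,k_2$ with $\frac{-k_1}{\pi}e^{\frac{4\pi}{n+1}k_2}>n+1$ put $$\rho_1=\sqrt{\tfrac{-k_1}{\pi}},\qquad \rho_2=\sqrt{\tfrac{n+1}{4\pi^2}\log\tfrac{-k_1}{\pi}+\tfrac{k_2}{\pi}}.$$ Let $\tilde{\mathbb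 X}_{k_1,k_2}$ be the set of $(\theta,r,\eta)\in \mathbb T^{n+1}\times\mathbb R_{>0}^{n+1}\times\mathbb T^{n+1}$ (indices $0,\dots,n$) with $\theta\in\operatorname{Im} f_*^t$, $\eta\in\operatorname{Im} f^t$, $-\pi\sum_i r_i^2=k_1$ and $-\frac1{2\pi}\log\prod_i r_i=k_2$, with the Riemannian metric induced by $\sum_i\big(dr_i^2+4\pi^2r_i^2d\theta_i^2+\frac{1}{4\pi^2r_i^2}d\eta_i^2\big)$, and let $\mathbb X^{n-1}_{k_1,k_2}=\tilde{\mathbb X}_{k_1,k_2}/(D\times D_*)$, the groups acting by translation on $\theta$ and $\eta$. It is a Riemannian manifold; its Riemannian distance is $+\infty$ between points of different components (this occurs only for $n=1$). Let $H^n=S^{2n+1}/N_*$, where $S^{2n+1}\subset\mathbb C^{n+1}$ is the unit sphere and $t\in N_*$ acts by $z_j\mapsto e^{2\pi i t_j}z_j$; thus $H^n=\mathbb{CP}^n/(\mathbb Z/(n+1))^{n-1}$. Define $$\pi_2:\mathbb X^{n-1}_{k_1,k_2}\to H^n,\qquad \pi_2([\theta,r,\eta])=\Big[\sqrt{\tfrac1{2\pi^2\rho_2^2}\log\tfrac{\rho_1}{r_j}}\;e^{-2\pi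 i\eta_j}\Big]_{j=0,\dots,n},$$ and let $\mathcal D\subset H^n$ be the hypersurface $\prod_i z_i=0$. We use the following distances. * The Fubini–Study distance on $H^n$: the quotient of the distance $\arccos|\langle z,w\rangle|$ ($\|z\|=\|w\|=1$) on $\mathbb{CP}^n$. * The degenerate distance $d_{\rho_1,\rho_2}$ on $H^n$: $d_{\rho_1,\rho_2}(p,q)$ is the infimum of the lengths, with respect to the metric $$\sum_{i}\Big(\frac{16\pi^4\rho_1^2\rho_2^4r_i^2}{e^{4\pi^2\rho_2^2r_i^2}}\,dr_i^2+\frac{e^{4\pi^2\rho_2^2r_i^2}}{4\pi^2\rho_1^2}\,d\eta_i^2\Big),$$ of the curves in $S^{2n+1}$, $C^1$ in polar coordinates $z_i=r_ie^{2\pi i\eta_i}$ up to the end points, whose end points project to $p$ and $q$ and which lie in $(\mathbb C^*)^{n+1}$ except possibly at the end points. (Off $\mathcal D$ this is the Riemannian distance of the quotient metric; the triangle inequality may fail at intermediate points of $\mathcal D$.) * On the image $\pi_2(\mathbb X^{n-1}_{k_1,k_2})$, as a space in its own right: the distance induced from $\mathbb X^{n-1}_{k_1,k_2}$ by $\pi_2$,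 i.e. the distance between fibres in $\mathbb X^{n-1}_{k_1,k_2}$ (the Riemannian distance of the metric making $\pi_2$ a Riemannian submersion onto its image). The *normalized distance* of two subsets $A,B$, for a distance $d$, is $\frac{2\,d_{\mathrm{Haus}}(A,B)}{\operatorname{diam}A+\operatorname{diam}B}$, where $d_{\mathrm{Haus}}(A,B)=\max\{\sup_{a\in A}\inf_{b\in B}d(a,b),\ \sup_{b\in B}\inf_{a\in A}d(a,b)\}$. **Theorem.** For every $\epsilon>0$ there are $R>0$ and $c>0$ (depending only on $n$ and $\epsilon$) such that for all $(k_1,k_2)$ as above with $\rho_2>R$ and $\rho_1\rho_2<c$: 1. every fibre of $\pi_2$, with its induced Riemannian metric, has diameter at most $\epsilon$; 2. the Gromov–Hausdorff distance between $\mathbb X^{n-1}_{k_1,k_2}$ and its image under $\pi_2$, with the distance induced by $\pi_2$, is less than $\epsilon$; 3. the Hausdorff distance between $\pi_2(\mathbb X^{n-1}_{k_1,k_2})$ and $\mathcal D$ in $H^n$, for the Fubini–Study distance, is less than $\epsilon$; 4. for the degenerate distance $d_{\rho_1,\rho_2}$ on $H^n$, the sets $\pi_2(\mathbb X^{n-1}_{k_1,k_2})$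 and $\mathcal D$ have finite diameter and their normalized distance is less than $\epsilon$. -/

import Mathlib

open scoped ENNReal

noncomputable section

namespace SelfDual

/-! ### Distances between sets and spaces, for `[0,∞]`-valued distance functions -/

/-- Hausdorff distance of two subsets with respect to a distance function `d`. -/
def hausdorff {α : Type*} (d : α → α → ℝ≥0∞) (A B : Set α) : ℝ≥0∞ :=
  max (⨆ a ∈ A, ⨅ b ∈ B, d a b) (⨆ b ∈ B, ⨅ a ∈ A, d b a)

/-- Diameter of a subset with respect to a distance function `d`. -/
def diameter {α : Type*} (d : α → α → ℝ≥0∞) (A : Set α) : ℝ≥0∞ :=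
  ⨆ a ∈ A, ⨆ b ∈ A, d a b

/-- Normalized distance of two subsets: their Hausdorff distance divided by the mean of their
diameters (with value `0` when both the distance and the diameters vanish). -/
def normalizedHausdorff {α : Type*} (d : α → α → ℝ≥0∞) (A B : Set α) : ℝ≥0∞ :=
  2 * hausdorff d A B / (diameter d A + diameter d B)

/-- The relation `S` is a correspondence between `α` and `β` of distortion at most `δ`. -/
def IsCorrespondence {α β : Type*} (dα : α → α → ℝ≥0∞) (dβ : β → β → ℝ≥0∞)
    (S : α → β → Prop) (δ : ℝ≥0∞) : Prop :=
  (∀ a, ∃ b, S a b) ∧ (∀ b, ∃ a, S a b) ∧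
    ∀ a b a' b', S a b → S a' b' → dα a a' ≤ dβ b b' + δ ∧ dβ b b' ≤ dα a a' + δ

/-- Gromov–Hausdorff distance: half the infimum of the distortions of all correspondences. -/
def gromovHausdorff {α β : Type*} (dα : α → α → ℝ≥0∞) (dβ : β → β → ℝ≥0∞) : ℝ≥0∞ :=
  sInf {δ : ℝ≥0∞ | ∃ S : α → β → Prop, IsCorrespondence dα dβ S δ} / 2

/-! ### The polytopes and the associated torus morphisms -/

/-- The torus `𝕋^m = (ℝ/ℤ)^m`. -/
abbrev Torus (m : ℕ) : Type := Fin m → UnitAddCircle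

/-- The vertices `(n,-1,…,-1), …, (-1,…,-1,n), (-1,…,-1)` of the polytope `Δ_n` of `ℂℙⁿ`. -/
def vertex (n : ℕ) (j : Fin (n + 1)) (i : Fin n) : ℤ :=
  if j = i.castSucc then (n : ℤ) else -1

/-- The vertices `(1,0,…,0), …, (0,…,0,1), (-1,…,-1)` of the dual polytope `Δ_n^*`. -/
def dualVertex (n : ℕ) (j : Fin (n + 1)) (i : Fin n) : ℤ :=
  if j = Fin.last n then -1 else if j = i.castSucc then 1 else 0

/-- The morphism `𝕋^{n+1} → 𝕋^n` induced by `x ↦ ∑ⱼ xⱼ aⱼ`, for integral vectors `aⱼ`. -/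
def torusMap {n : ℕ} (a : Fin (n + 1) → Fin n → ℤ) : Torus (n + 1) →+ Torus n where
  toFun x := fun i => ∑ j, a j i • x j
  map_zero' := by ext i; simp
  map_add' x y := by ext i; simp [Finset.sum_add_distrib]

/-- The morphism `𝕋^n → 𝕋^{n+1}` induced by the transpose of `x ↦ ∑ⱼ xⱼ aⱼ`. -/
def torusMapTranspose {n : ℕ} (a : Fin (n + 1) → Fin n → ℤ) : Torus n →+ Torus (n + 1) where
  toFun y := fun j => ∑ i, a j i • y i
  map_zero' := by ext j; simp
  map_add' x y := by ext j; simp [Finset.sum_add_distrib]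

/-- `f_{Δ_n}`: it uses the vertices of the dual polytope. -/
def f (n : ℕ) : Torus (n + 1) →+ Torus n := torusMap (dualVertex n)

/-- `f_{Δ_n^*}`: it uses the vertices of `Δ_n`. -/
def fDual (n : ℕ) : Torus (n + 1) →+ Torus n := torusMap (vertex n)

/-- `f_{Δ_n}^*`. -/
def fTranspose (n : ℕ) : Torus n →+ Torus (n + 1) := torusMapTranspose (dualVertex n)

/-- `f_{Δ_n^*}^*`. -/
def fDualTranspose (n : ℕ) : Torus n →+ Torus (n + 1) := torusMapTranspose (vertex n)

/-- `N_{Δ_n} = ker f_{Δ_n}`. -/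
def N (n : ℕ) : AddSubgroup (Torus (n + 1)) := (f n).ker

/-- `N_{Δ_n^*} = ker f_{Δ_n^*}`. -/
def NDual (n : ℕ) : AddSubgroup (Torus (n + 1)) := (fDual n).ker

/-- `D_{Δ_n} = N_{Δ_n} ∩ Im f_{Δ_n^*}^*`. -/
def D (n : ℕ) : AddSubgroup (Torus (n + 1)) := N n ⊓ (fDualTranspose n).range

/-- `D_{Δ_n^*} = N_{Δ_n^*} ∩ Im f_{Δ_n}^*`. -/
def DDual (n : ℕ) : AddSubgroup (Torus (n + 1)) := NDual n ⊓ (fTranspose n).range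

/-! ### The manifold `𝕏^{n-1}_{k₁,k₂}` -/

/-- The fibred product of two copies of `(ℂ^*)^{n+1}` over the moment map `-(π r₀²,…,π rₙ²)`, in
its global coordinates `(θ, r, η)`: the point `(θ, r, η)` stands for the pair
`(rⱼ e^{2πiθⱼ})ⱼ, (rⱼ e^{2πiηⱼ})ⱼ`. -/
structure FibredProduct (n : ℕ) where
  theta : Torus (n + 1)
  r : Fin (n + 1) → ℝ
  eta : Torus (n + 1)
  r_pos : ∀ i, 0 < r i

/-- `μ₁ = -π ∑ rᵢ²`. -/
def mu₁ {n : ℕ} (p : FibredProduct n) : ℝ := -(Real.pi * ∑ i, p.r i ^ 2)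

/-- `μ₂ = -(1/2π) log ∏ rᵢ`. -/
def mu₂ {n : ℕ} (p : FibredProduct n) : ℝ := -(1 / (2 * Real.pi) * Real.log (∏ i, p.r i))

/-- The condition on `(k₁,k₂)` under which `𝕏_{k₁,k₂}` is defined (it is nonempty and `(k₁,k₂)`
is a regular value of `(μ₁,μ₂)`). -/
def IsAdmissible (n : ℕ) (k₁ k₂ : ℝ) : Prop :=
  (n : ℝ) + 1 < -k₁ / Real.pi * Real.exp (4 * Real.pi / ((n : ℝ) + 1) * k₂)

/-- `ρ₁ = √(-k₁/π)`. -/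
def rho₁ (k₁ : ℝ) : ℝ := Real.sqrt (-k₁ / Real.pi)

/-- `ρ₂ = √((n+1)/(4π²) log(-k₁/π) + k₂/π)`. -/
def rho₂ (n : ℕ) (k₁ k₂ : ℝ) : ℝ :=
  Real.sqrt (((n : ℝ) + 1) / (4 * Real.pi ^ 2) * Real.log (-k₁ / Real.pi) + k₂ / Real.pi)

/-- The manifold `𝕏̃_{k₁,k₂}`. -/
def XTilde (n : ℕ) (k₁ k₂ : ℝ) : Set (FibredProduct n) :=
  {p | p.theta ∈ (fDualTranspose n).range ∧ p.eta ∈ (fTranspose n).range ∧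
    mu₁ p = k₁ ∧ mu₂ p = k₂}

/-- The equivalence relation on `𝕏̃_{k₁,k₂}` given by the action of `D_{Δ_n} × D_{Δ_n^*}` by
translations of `θ` and `η`. -/
instance XSetoid (n : ℕ) (k₁ k₂ : ℝ) : Setoid (XTilde n k₁ k₂) where
  r p q := q.1.theta - p.1.theta ∈ D n ∧ q.1.r = p.1.r ∧ q.1.eta - p.1.eta ∈ DDual n
  iseqv :=
    { refl := fun p => by simp [zero_mem]
      symm := fun {p q} h =>
        ⟨by simpa using neg_mem h.1, h.2.1.symm, by simpa using neg_mem h.2.2⟩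
      trans := fun {p q s} h h' =>
        ⟨by simpa using add_mem h'.1 h.1, h'.2.1.trans h.2.1,
          by simpa using add_mem h'.2.2 h.2.2⟩ }

/-- The manifold `𝕏^{n-1}_{k₁,k₂} = 𝕏̃_{k₁,k₂} / (D_{Δ_n} × D_{Δ_n^*})`. -/
def X (n : ℕ) (k₁ k₂ : ℝ) : Type := Quotient (XSetoid n k₁ k₂)

/-- The projection `𝕏̃_{k₁,k₂} → 𝕏_{k₁,k₂}`. -/
def X.mk {n : ℕ} {k₁ k₂ : ℝ} (p : XTilde n k₁ k₂) : X n k₁ k₂ := Quotient.mk _ p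

/-- A `C¹` curve `[0,1] → 𝕏̃_{k₁,k₂}`, together with real lifts of its angular coordinates.
Every `C¹` curve in the quotient `𝕏_{k₁,k₂}` is the projection of such a curve. -/
structure XCurve (n : ℕ) (k₁ k₂ : ℝ) where
  theta : ℝ → Fin (n + 1) → ℝ
  r : ℝ → Fin (n + 1) → ℝ
  eta : ℝ → Fin (n + 1) → ℝ
  contDiff_theta : ContDiff ℝ 1 theta
  contDiff_r : ContDiff ℝ 1 r
  contDiff_eta : ContDiff ℝ 1 eta
  point : unitInterval → XTilde n k₁ k₂
  point_theta : ∀ t i, (point t).1.theta i = ((theta t i : ℝ) : UnitAddCircle)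
  point_r : ∀ t i, (point t).1.r i = r t i
  point_eta : ∀ t i, (point t).1.eta i = ((eta t i : ℝ) : UnitAddCircle)

/-- Length of a curve for the metric `∑ᵢ (drᵢ² + 4π² rᵢ² dθᵢ² + dηᵢ² / (4π² rᵢ²))`. -/
def XCurve.length {n : ℕ} {k₁ k₂ : ℝ} (c : XCurve n k₁ k₂) : ℝ≥0∞ :=
  ∫⁻ t in Set.Icc (0 : ℝ) 1, ENNReal.ofReal (Real.sqrt (∑ i,
    (deriv (fun s => c.r s i) t ^ 2
      + 4 * Real.pi ^ 2 * c.r t i ^ 2 * deriv (fun s => c.theta s i) t ^ 2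
      + 1 / (4 * Real.pi ^ 2 * c.r t i ^ 2) * deriv (fun s => c.eta s i) t ^ 2)))

/-- For a subset `A` of `𝕏_{k₁,k₂}`, the intrinsic Riemannian distance of `A`: the infimum of the
lengths of the `C¹` curves in `A` from `x` to `y` (so `∞` if there is none). -/
def X.distIn {n : ℕ} {k₁ k₂ : ℝ} (A : Set (X n k₁ k₂)) (x y : X n k₁ k₂) : ℝ≥0∞ :=
  ⨅ (c : XCurve n k₁ k₂) (_ : X.mk (c.point 0) = x) (_ : X.mk (c.point 1) = y)
    (_ : ∀ t, X.mk (c.point t) ∈ A), c.length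

/-- The Riemannian distance of `𝕏_{k₁,k₂}`. -/
def X.dist {n : ℕ} {k₁ k₂ : ℝ} (x y : X n k₁ k₂) : ℝ≥0∞ := X.distIn Set.univ x y

/-! ### The space `Hⁿ` -/

/-- The unit sphere of `ℂ^{n+1}`. -/
abbrev USphere (n : ℕ) : Type := Metric.sphere (0 : EuclideanSpace ℂ (Fin (n + 1))) 1

/-- The equivalence relation on the unit sphere given by the action of
`N_{Δ_n^*} ⊆ 𝕋^{n+1}`, where `t` acts by `zⱼ ↦ e^{2πi tⱼ} zⱼ`. -/
instance HSetoid (n : ℕ) : Setoid (USphere n) where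
  r z w := ∃ t ∈ NDual n, ∀ i, w.1 i = (AddCircle.toCircle (t i) : ℂ) * z.1 i
  iseqv :=
    { refl := fun z => ⟨0, zero_mem _, fun i => by simp⟩
      symm := by
        rintro z w ⟨t, ht, h⟩
        refine ⟨-t, neg_mem ht, fun i => ?_⟩
        rw [h i, ← mul_assoc, ← Circle.coe_mul, ← AddCircle.toCircle_add]
        simp
      trans := by
        rintro z w v ⟨t, ht, h⟩ ⟨u, hu, h'⟩
        refine ⟨u + t, add_mem hu ht, fun i => ?_⟩
        rw [h' i, h i, ← mul_assoc, ← Circle.coe_mul, ← AddCircle.toCircle_add]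
        simp }

/-- The toric space `Hⁿ` of the polytope `Δ_n^*`, presented by symplectic reduction as
`S^{2n+1} / N_{Δ_n^*}`. As `N_{Δ_n^*}` is the product of the diagonal circle with the group of
the `t` with `(n+1) t = 0` and `∑ tⱼ = 0`, this is `ℂℙⁿ / (ℤ/(n+1))^{n-1}`. -/
def H (n : ℕ) : Type := Quotient (HSetoid n)

/-- The projection `S^{2n+1} → Hⁿ`. -/
def H.mk {n : ℕ} (z : USphere n) : H n := Quotient.mk _ z

/-- The hypersurface `∏ zᵢ = 0` in `Hⁿ`. -/
def H.divisor (n : ℕ) : Set (H n) := {p | ∃ z : USphere n, H.mk z = p ∧ ∏ i, z.1 i = 0}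

/-- The Fubini–Study distance of `Hⁿ`: the quotient of the Fubini–Study distance
`arccos |⟨z,w⟩|` of `ℂℙⁿ`. -/
def H.fubiniStudy {n : ℕ} (p q : H n) : ℝ≥0∞ :=
  ⨅ (z : USphere n) (w : USphere n) (_ : H.mk z = p) (_ : H.mk w = q),
    ENNReal.ofReal (Real.arccos ‖inner ℂ z.1 w.1‖)

/-- A `C¹` curve `[0,1] → S^{2n+1}` in polar coordinates `zⱼ = rⱼ e^{2πiηⱼ}`, which lies in
`(ℂ^*)^{n+1}` except possibly at its end points. -/
structure PolarCurve (n : ℕ) where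
  r : ℝ → Fin (n + 1) → ℝ
  eta : ℝ → Fin (n + 1) → ℝ
  contDiff_r : ContDiff ℝ 1 r
  contDiff_eta : ContDiff ℝ 1 eta
  point : unitInterval → USphere n
  point_eq : ∀ t i, (point t).1 i =
    (r t i : ℂ) * (AddCircle.toCircle ((eta t i : ℝ) : UnitAddCircle) : ℂ)
  r_nonneg : ∀ t ∈ Set.Icc (0 : ℝ) 1, ∀ i, 0 ≤ r t i
  r_pos : ∀ t ∈ Set.Ioo (0 : ℝ) 1, ∀ i, 0 < r t i

/-- Length of a curve for the `(r,η)` part of the metric pulled back by `φ_{ρ₁,ρ₂}`, i.e.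
`∑ᵢ 16π⁴ρ₁²ρ₂⁴rᵢ² e^{-4π²ρ₂²rᵢ²} drᵢ² + e^{4π²ρ₂²rᵢ²} / (4π²ρ₁²) dηᵢ²`. -/
def PolarCurve.length {n : ℕ} (ρ₁ ρ₂ : ℝ) (c : PolarCurve n) : ℝ≥0∞ :=
  ∫⁻ t in Set.Icc (0 : ℝ) 1, ENNReal.ofReal (Real.sqrt (∑ i,
    (16 * Real.pi ^ 4 * ρ₁ ^ 2 * ρ₂ ^ 4 * c.r t i ^ 2
        / Real.exp (4 * Real.pi ^ 2 * ρ₂ ^ 2 * c.r t i ^ 2) * deriv (fun s => c.r s i) t ^ 2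
      + Real.exp (4 * Real.pi ^ 2 * ρ₂ ^ 2 * c.r t i ^ 2) / (4 * Real.pi ^ 2 * ρ₁ ^ 2)
        * deriv (fun s => c.eta s i) t ^ 2)))

/-- The degenerate distance on `Hⁿ` induced, through the projection from
`S^{2n+1} ∩ (ℂ^*)^{n+1}`, by the metric pulled back by `φ_{ρ₁,ρ₂}`: the infimum of the lengths of
the curves upstairs whose end points project to `p` and `q`, and which stay in `(ℂ^*)^{n+1}`, where
the metric lives, except possibly at the end points. Off the divisor it is the Riemannian distance
of the quotient metric. -/
def H.degenerateDist {n : ℕ} (ρ₁ ρ₂ : ℝ) (p q : H n) : ℝ≥0∞ :=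
  ⨅ (c : PolarCurve n) (_ : H.mk (c.point 0) = p) (_ : H.mk (c.point 1) = q), c.length ρ₁ ρ₂

/-! ### The map `π₂ : 𝕏_{k₁,k₂} → Hⁿ` -/

/-- The vector with entries `√(log(ρ₁/rⱼ) / (2π²ρ₂²)) e^{-2πiηⱼ}`. -/
def piTwoVec {n : ℕ} (k₁ k₂ : ℝ) (p : FibredProduct n) : EuclideanSpace ℂ (Fin (n + 1)) :=
  WithLp.toLp 2 fun i =>
    ((Real.sqrt (1 / (2 * Real.pi ^ 2 * rho₂ n k₁ k₂ ^ 2) * Real.log (rho₁ k₁ / p.r i)) : ℝ) : ℂ)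
      * (AddCircle.toCircle (-p.eta i) : ℂ)

lemma IsAdmissible.neg {n : ℕ} {k₁ k₂ : ℝ} (h : IsAdmissible n k₁ k₂) : 0 < -k₁ / Real.pi := by
  unfold IsAdmissible at h
  have h1 : (0 : ℝ) < (n : ℝ) + 1 := by positivity
  exact pos_of_mul_pos_left (h1.trans h) (Real.exp_pos _).le

lemma IsAdmissible.rho₂_arg_pos {n : ℕ} {k₁ k₂ : ℝ} (h : IsAdmissible n k₁ k₂) :
    0 < ((n : ℝ) + 1) / (4 * Real.pi ^ 2) * Real.log (-k₁ / Real.pi) + k₂ / Real.pi := by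
  have hn : (1 : ℝ) ≤ (n : ℝ) + 1 := by simp
  have hk := h.neg
  have h2 : 0 < Real.log (-k₁ / Real.pi * Real.exp (4 * Real.pi / ((n : ℝ) + 1) * k₂)) :=
    Real.log_pos (lt_of_le_of_lt hn h)
  rw [Real.log_mul hk.ne' (Real.exp_pos _).ne', Real.log_exp] at h2
  have h3 : ((n : ℝ) + 1) / (4 * Real.pi ^ 2) * Real.log (-k₁ / Real.pi) + k₂ / Real.pi
      = ((n : ℝ) + 1) / (4 * Real.pi ^ 2)
        * (Real.log (-k₁ / Real.pi) + 4 * Real.pi / ((n : ℝ) + 1) * k₂) := by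
    field_simp
  rw [h3]
  positivity

lemma norm_piTwoVec {n : ℕ} {k₁ k₂ : ℝ} (h : IsAdmissible n k₁ k₂) (p : FibredProduct n)
    (hp : p ∈ XTilde n k₁ k₂) : ‖piTwoVec k₁ k₂ p‖ = 1 := by
  obtain ⟨-, -, h1, h2⟩ := hp
  have hπ := Real.pi_pos
  have hk := h.neg
  have hρ1 : 0 < rho₁ k₁ := Real.sqrt_pos.2 hk
  have hρ2sq : rho₂ n k₁ k₂ ^ 2
      = ((n : ℝ) + 1) / (4 * Real.pi ^ 2) * Real.log (-k₁ / Real.pi) + k₂ / Real.pi :=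
    Real.sq_sqrt h.rho₂_arg_pos.le
  have hρ2 : 0 < rho₂ n k₁ k₂ ^ 2 := by rw [hρ2sq]; exact h.rho₂_arg_pos
  have hρ1sq : rho₁ k₁ ^ 2 = -k₁ / Real.pi := Real.sq_sqrt hk.le
  have hsum : ∑ i, p.r i ^ 2 = rho₁ k₁ ^ 2 := by
    rw [hρ1sq, ← h1, mu₁]; field_simp
  have hle : ∀ i, p.r i ≤ rho₁ k₁ := fun i => by
    refine le_of_sq_le_sq ?_ hρ1.le
    rw [← hsum]
    exact Finset.single_le_sum (f := fun j => p.r j ^ 2) (fun j _ => sq_nonneg _)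
      (Finset.mem_univ i)
  have hlog : ∀ i, 0 ≤ 1 / (2 * Real.pi ^ 2 * rho₂ n k₁ k₂ ^ 2) * Real.log (rho₁ k₁ / p.r i) :=
    fun i => mul_nonneg (by positivity)
      (Real.log_nonneg ((one_le_div (p.r_pos i)).2 (hle i)))
  have hlogsum : ∑ i, Real.log (rho₁ k₁ / p.r i) = 2 * Real.pi ^ 2 * rho₂ n k₁ k₂ ^ 2 := by
    have e1 : ∀ i, Real.log (rho₁ k₁ / p.r i) = Real.log (rho₁ k₁) - Real.log (p.r i) :=
      fun i => Real.log_div hρ1.ne' (p.r_pos i).ne'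
    have e2 : Real.log (-k₁ / Real.pi) = 2 * Real.log (rho₁ k₁) := by
      rw [← hρ1sq, Real.log_pow]; norm_num
    have e3 : ∑ i, Real.log (p.r i) = - (2 * Real.pi * k₂) := by
      rw [← Real.log_prod (fun i _ => (p.r_pos i).ne'), ← h2, mu₂]; field_simp
    simp only [e1, Finset.sum_sub_distrib, e3, hρ2sq, e2]
    simp
    field_simp
    ring
  have hsq : ‖piTwoVec k₁ k₂ p‖ ^ 2 = 1 := by
    rw [EuclideanSpace.norm_sq_eq]
    have : ∀ i, ‖(piTwoVec k₁ k₂ p) i‖ ^ 2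
        = 1 / (2 * Real.pi ^ 2 * rho₂ n k₁ k₂ ^ 2) * Real.log (rho₁ k₁ / p.r i) := fun i => by
      simp only [piTwoVec, norm_mul, Circle.norm_coe, mul_one, Complex.norm_real,
        Real.norm_eq_abs, sq_abs]
      exact Real.sq_sqrt (hlog i)
    simp only [this]
    rw [← Finset.mul_sum, hlogsum]
    exact one_div_mul_cancel (by positivity)
  nlinarith [norm_nonneg (piTwoVec k₁ k₂ p)]

/-- The map `π₂([θ,r,η]) = [√(log(ρ₁/rⱼ) / (2π²ρ₂²)) e^{-2πiηⱼ}]ⱼ` from `𝕏_{k₁,k₂}` to `Hⁿ`. -/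
def piTwo {n : ℕ} {k₁ k₂ : ℝ} (h : IsAdmissible n k₁ k₂) : X n k₁ k₂ → H n :=
  Quotient.lift
    (fun p : XTilde n k₁ k₂ => H.mk ⟨piTwoVec k₁ k₂ p.1, by simp [norm_piTwoVec h p.1 p.2]⟩)
    (by
      rintro p q ⟨-, hr, hη⟩
      refine Quotient.sound ⟨-(q.1.eta - p.1.eta), neg_mem hη.1, fun i => ?_⟩
      simp only [piTwoVec, hr]
      rw [mul_left_comm, ← Circle.coe_mul, ← AddCircle.toCircle_add]
      congr 3
      simp only [Pi.neg_apply, Pi.sub_apply]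
      abel)

/-- The distance between the fibres of `π₂` over `p` and `q`. On the image of `π₂` this is the
Riemannian distance of the metric which makes `π₂` a Riemannian submersion onto its image. -/
def fibreDist {n : ℕ} {k₁ k₂ : ℝ} (h : IsAdmissible n k₁ k₂) (p q : H n) : ℝ≥0∞ :=
  ⨅ (x : X n k₁ k₂) (y : X n k₁ k₂) (_ : piTwo h x = p) (_ : piTwo h y = q), X.dist x y

end SelfDual

end

namespace SelfDual

/-! ### Torus computations -/

/-! Put L = 4π²ρ₂² and let aᵢ be the squared modulus of the i-th coordinate of a point in the image
of π₂. The two moment equations become ∑ aᵢ = 1 and ∑ exp(-L aᵢ) = 1, and rᵢ = ρ₁ exp(-L aᵢ / 2).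

Fibres. A fibre of π₂ is swept out by the angles θ, whose metric coefficients 4π²rᵢ² are at most
4π²ρ₁². Adding a linear drift in θ to a curve thus costs O(ρ₁) (`exists_translate`). Applied to a
constant curve, this bounds the diameter of a fibre; applied to a curve between two fibres, it moves
the end points to prescribed ones, so the graph of π₂ is a correspondence of distortion O(ρ₁). For
ρ₂ > 1, ρ₁ is at most ρ₁ρ₂.

Position of the image. Since n+1 exponentials add up to 1, some aᵢ is at most log(n+1)/L, and
deleting that coordinate leads to the divisor. Conversely, the segment of weights from a divisor
point to the barycentre meets the image, by the intermediate value theorem, at a parameter at most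
(n+1)log(n+1)/L. Both moves keep the angles (`RadiallyClose`), and they are short for Fubini–Study
when ρ₂ is large.

Degenerate metric. As x ≤ eˣ, the radial coefficients are at most (2πρ₁ρ₂)², so points with equal
angles are at distance O(ρ₁ρ₂). The angular coefficients are at least 1/(4π²ρ₁²), and η₀ - ηₙ is
well defined modulo 1/(n+1) on the image, so the image has diameter at least a constant times 1/ρ₁
(`le_diameter_range`). The normalized distance is therefore O(ρ₁²ρ₂). -/

theorem coe_int_unitAddCircle (m : ℤ) : (((m : ℤ) : ℝ) : UnitAddCircle) = 0 :=
  (AddCircle.coe_eq_zero_iff (1 : ℝ)).2 ⟨m, by simp⟩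

theorem coe_sum_unitAddCircle {ι : Type*} (s : Finset ι) (x : ι → ℝ) :
    ((∑ i ∈ s, x i : ℝ) : UnitAddCircle) = ∑ i ∈ s, (x i : UnitAddCircle) :=
  map_sum (QuotientAddGroup.mk' (AddSubgroup.zmultiples (1 : ℝ))) x s

/-- A point of the torus whose coordinates add up to `0` has a bounded real lift with the same
property. -/
theorem exists_lift_sum_eq_zero {n : ℕ} (d : Torus (n + 1)) (hd : ∑ i, d i = 0) :
    ∃ δ : Fin (n + 1) → ℝ, (∀ i, (δ i : UnitAddCircle) = d i) ∧ ∑ i, δ i = 0 ∧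
      ∀ i, |δ i| ≤ n + 1 := by
  choose x hx using fun i => QuotientAddGroup.mk_surjective (d i)
  have hfr : ∀ i, ((Int.fract (x i) : ℝ) : UnitAddCircle) = d i := fun i => by
    rw [← hx i, Int.fract, AddCircle.coe_sub, coe_int_unitAddCircle, sub_zero]
  have hs : ((∑ i, Int.fract (x i) : ℝ) : UnitAddCircle) = 0 := by
    rw [coe_sum_unitAddCircle]; simpa only [hfr] using hd
  obtain ⟨m, hm⟩ := (AddCircle.coe_eq_zero_iff (1 : ℝ)).1 hs
  have hm' : (m : ℝ) = ∑ i, Int.fract (x i) := by simpa using hm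
  have h0 : (0 : ℝ) ≤ m := by
    rw [hm']; exact Finset.sum_nonneg fun i _ => Int.fract_nonneg _
  have h1 : (m : ℝ) ≤ n + 1 := by
    rw [hm']
    calc ∑ i, Int.fract (x i) ≤ ∑ _i : Fin (n + 1), (1 : ℝ) :=
          Finset.sum_le_sum fun i _ => (Int.fract_lt_one _).le
      _ = n + 1 := by simp
  -- The fractional parts add up to an integer m between 0 and n+1; subtracting all of m from
  -- coordinate 0 changes no class and explains the bound n+1.
  refine ⟨fun i => Int.fract (x i) - if i = 0 then (m : ℝ) else 0, fun i => ?_, ?_, fun i => ?_⟩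
  · dsimp only
    split_ifs
    · rw [AddCircle.coe_sub, coe_int_unitAddCircle, sub_zero, hfr]
    · rw [sub_zero, hfr]
  · rw [Finset.sum_sub_distrib, ← hm']; simp
  · have h2 := Int.fract_nonneg (x i)
    have h3 := (Int.fract_lt_one (x i)).le
    have h4 : (0 : ℝ) ≤ n := n.cast_nonneg
    rw [abs_le]
    dsimp only
    split_ifs <;> constructor <;> linarith

theorem fTranspose_castSucc {n : ℕ} (y : Torus n) (k : Fin n) :
    fTranspose n y k.castSucc = y k := by
  simp [fTranspose, torusMapTranspose, dualVertex, (Fin.castSucc_lt_last k).ne]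

theorem fTranspose_last {n : ℕ} (y : Torus n) :
    fTranspose n y (Fin.last n) = -∑ i, y i := by
  simp [fTranspose, torusMapTranspose, dualVertex]

theorem fDualTranspose_castSucc {n : ℕ} (y : Torus n) (k : Fin n) :
    fDualTranspose n y k.castSucc = (n + 1) • y k - ∑ i, y i := by
  have h : ∀ i, (if k = i then (n : ℤ) else -1) • y i = (if k = i then (n + 1) • y i else 0) - y i :=
    fun i => by
      split_ifs
      · simp [add_smul]
      · simp
  have h' : fDualTranspose n y k.castSucc = ∑ i, (if k = i then (n : ℤ) else -1) • y i := by
    simp only [fDualTranspose, torusMapTranspose, vertex, AddMonoidHom.coe_mk, ZeroHom.coe_mk,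
      Fin.castSucc_inj]
  rw [h', Finset.sum_congr rfl fun i _ => h i, Finset.sum_sub_distrib]
  simp

theorem fDualTranspose_last {n : ℕ} (y : Torus n) :
    fDualTranspose n y (Fin.last n) = -∑ i, y i := by
  have h : ∀ i : Fin n, (Fin.last n = i.castSucc) = False := fun i =>
    eq_false (Fin.castSucc_lt_last i).ne'
  simp [fDualTranspose, torusMapTranspose, vertex, h]

theorem mem_range_fTranspose {n : ℕ} {η : Torus (n + 1)} :
    η ∈ (fTranspose n).range ↔ ∑ i, η i = 0 := by
  constructor
  · rintro ⟨y, rfl⟩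
    rw [Fin.sum_univ_castSucc]
    simp [fTranspose_castSucc, fTranspose_last]
  · intro h
    refine ⟨fun k => η k.castSucc, ?_⟩
    rw [Fin.sum_univ_castSucc] at h
    ext j
    refine Fin.lastCases ?_ (fun k => ?_) j
    · rw [fTranspose_last]; exact neg_eq_of_add_eq_zero_right h
    · rw [fTranspose_castSucc]

/-- The image is a full subtorus because division by n+1 is possible after lifting to ℝ. Hence θ and
η obey the same constraint. -/
theorem mem_range_fDualTranspose {n : ℕ} {θ : Torus (n + 1)} :
    θ ∈ (fDualTranspose n).range ↔ ∑ i, θ i = 0 := by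
  constructor
  · rintro ⟨y, rfl⟩
    rw [Fin.sum_univ_castSucc]
    simp only [fDualTranspose_castSucc, fDualTranspose_last, Finset.sum_sub_distrib,
      Finset.sum_const, Finset.card_univ, Fintype.card_fin]
    rw [← Finset.smul_sum, add_smul, one_smul]
    abel
  · intro h
    obtain ⟨x, hx, hs, -⟩ := exists_lift_sum_eq_zero θ h
    rw [Fin.sum_univ_castSucc] at hs
    have hn : (n : ℝ) + 1 ≠ 0 := by positivity
    -- The last coordinate requires -∑ yᵢ = x_last, and the others then read (n+1) yₖ + x_last = xₖ,
    -- which dictates yₖ.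
    have hsum : -∑ k : Fin n, (x k.castSucc - x (Fin.last n)) / ((n : ℝ) + 1) = x (Fin.last n) := by
      rw [← Finset.sum_div, Finset.sum_sub_distrib]
      simp only [Finset.sum_const, Finset.card_univ, Fintype.card_fin, nsmul_eq_mul]
      field_simp
      linarith
    have hsum' : -∑ k : Fin n, (((x k.castSucc - x (Fin.last n)) / ((n : ℝ) + 1) : ℝ) :
        UnitAddCircle) = θ (Fin.last n) := by
      rw [← coe_sum_unitAddCircle, ← AddCircle.coe_neg, hsum, hx]
    refine ⟨fun k => (((x k.castSucc - x (Fin.last n)) / ((n : ℝ) + 1) : ℝ) : UnitAddCircle), ?_⟩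
    ext j
    refine Fin.lastCases ?_ (fun k => ?_) j
    · rw [fDualTranspose_last]; exact hsum'
    · rw [fDualTranspose_castSucc, sub_eq_add_neg, hsum', ← hx (Fin.last n), ← hx k.castSucc,
        ← AddCircle.coe_nsmul, ← AddCircle.coe_add]
      congr 1
      rw [nsmul_eq_mul]
      push_cast
      field_simp
      ring

/-! ### The group acting on the sphere -/

theorem fDual_apply {n : ℕ} (x : Torus (n + 1)) (i : Fin n) :
    fDual n x i = (n + 1) • x i.castSucc - ∑ j, x j := by
  have h : ∀ j, (if j = i.castSucc then (n : ℤ) else -1) • x j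
      = (if j = i.castSucc then (n + 1) • x j else 0) - x j := fun j => by
    split_ifs
    · simp [add_smul]
    · simp
  have h' : fDual n x i = ∑ j, (if j = i.castSucc then (n : ℤ) else -1) • x j := by
    simp only [fDual, torusMap, vertex, AddMonoidHom.coe_mk, ZeroHom.coe_mk]
  rw [h', Finset.sum_congr rfl fun i _ => h i, Finset.sum_sub_distrib]
  simp

theorem const_mem_NDual (n : ℕ) (t : UnitAddCircle) : (fun _ => t) ∈ NDual n := by
  rw [NDual, AddMonoidHom.mem_ker]
  ext i
  rw [fDual_apply]
  simp

/-- Differences of coordinates of an element of `NDual n` are therefore (n+1)-torsion. The kernel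
equations give this for the first n coordinates; adding them up gives the last. -/
theorem smul_eq_sum_of_mem_NDual {n : ℕ} {x : Torus (n + 1)} (hx : x ∈ NDual n)
    (j : Fin (n + 1)) : (n + 1) • x j = ∑ i, x i := by
  have h : ∀ k : Fin n, (n + 1) • x k.castSucc = ∑ i, x i := fun k => by
    have := congrFun ((AddMonoidHom.mem_ker).1 hx) k
    rw [fDual_apply] at this
    exact sub_eq_zero.1 this
  refine Fin.lastCases ?_ h j
  have h1 : (n + 1) • ∑ i, x i = n • (∑ i, x i) + (n + 1) • x (Fin.last n) := by
    conv_lhs => rw [Fin.sum_univ_castSucc]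
    rw [smul_add, Finset.smul_sum]
    simp [h]
  rw [add_smul, one_smul] at h1
  exact (add_left_cancel h1).symm

/-! ### The radial coordinates -/

theorem IsAdmissible.rho₁_pos {k₁ k₂ : ℝ} {n : ℕ} (h : IsAdmissible n k₁ k₂) : 0 < rho₁ k₁ :=
  Real.sqrt_pos.2 h.neg

theorem IsAdmissible.rho₂_pos {k₁ k₂ : ℝ} {n : ℕ} (h : IsAdmissible n k₁ k₂) :
    0 < rho₂ n k₁ k₂ :=
  Real.sqrt_pos.2 h.rho₂_arg_pos

theorem sum_r_sq {n : ℕ} {k₁ k₂ : ℝ} (h : IsAdmissible n k₁ k₂) {p : FibredProduct n}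
    (hp : p ∈ XTilde n k₁ k₂) : ∑ i, p.r i ^ 2 = rho₁ k₁ ^ 2 := by
  rw [rho₁, Real.sq_sqrt h.neg.le, ← hp.2.2.1, mu₁]
  field_simp

theorem r_le_rho₁ {n : ℕ} {k₁ k₂ : ℝ} (h : IsAdmissible n k₁ k₂) {p : FibredProduct n}
    (hp : p ∈ XTilde n k₁ k₂) (i : Fin (n + 1)) : p.r i ≤ rho₁ k₁ := by
  refine le_of_sq_le_sq ?_ h.rho₁_pos.le
  rw [← sum_r_sq h hp]
  exact Finset.single_le_sum (f := fun j => p.r j ^ 2) (fun j _ => sq_nonneg _)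
    (Finset.mem_univ i)

/-- The squared modulus of the `i`-th homogeneous coordinate of `π₂(p)`. -/
noncomputable def weight {n : ℕ} (k₁ k₂ : ℝ) (p : FibredProduct n) (i : Fin (n + 1)) : ℝ :=
  1 / (2 * Real.pi ^ 2 * rho₂ n k₁ k₂ ^ 2) * Real.log (rho₁ k₁ / p.r i)

theorem weight_nonneg {n : ℕ} {k₁ k₂ : ℝ} (h : IsAdmissible n k₁ k₂) {p : FibredProduct n}
    (hp : p ∈ XTilde n k₁ k₂) (i : Fin (n + 1)) : 0 ≤ weight k₁ k₂ p i :=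
  mul_nonneg (by positivity)
    (Real.log_nonneg ((one_le_div (p.r_pos i)).2 (r_le_rho₁ h hp i)))

theorem exp_neg_weight {n : ℕ} {k₁ k₂ : ℝ} (h : IsAdmissible n k₁ k₂) (p : FibredProduct n)
    (i : Fin (n + 1)) :
    Real.exp (-(2 * Real.pi ^ 2 * rho₂ n k₁ k₂ ^ 2 * weight k₁ k₂ p i)) = p.r i / rho₁ k₁ := by
  have h1 := h.rho₁_pos
  have h2 := h.rho₂_pos
  have h3 := p.r_pos i
  have hπ := Real.pi_pos
  have : 2 * Real.pi ^ 2 * rho₂ n k₁ k₂ ^ 2 * weight k₁ k₂ p i = Real.log (rho₁ k₁ / p.r i) := by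
    rw [weight]; field_simp
  rw [this, Real.exp_neg, Real.exp_log (by positivity), inv_div]

theorem piTwoVec_apply {n : ℕ} (k₁ k₂ : ℝ) (p : FibredProduct n) (i : Fin (n + 1)) :
    piTwoVec k₁ k₂ p i = ((Real.sqrt (weight k₁ k₂ p i) : ℝ) : ℂ)
      * (AddCircle.toCircle (-p.eta i) : ℂ) := rfl

theorem sum_weight {n : ℕ} {k₁ k₂ : ℝ} (h : IsAdmissible n k₁ k₂) {p : FibredProduct n}
    (hp : p ∈ XTilde n k₁ k₂) : ∑ i, weight k₁ k₂ p i = 1 := by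
  have h1 : ‖piTwoVec k₁ k₂ p‖ ^ 2 = 1 := by rw [norm_piTwoVec h p hp]; norm_num
  rw [EuclideanSpace.norm_sq_eq] at h1
  rw [← h1]
  refine Finset.sum_congr rfl fun i _ => ?_
  rw [piTwoVec_apply, norm_mul, Circle.norm_coe, mul_one, Complex.norm_real, Real.norm_eq_abs,
    sq_abs, Real.sq_sqrt (weight_nonneg h hp i)]

/-- With `sum_weight`, this describes the radial part of the image; `exists_mem_XTilde` is the
converse. -/
theorem sum_exp_weight {n : ℕ} {k₁ k₂ : ℝ} (h : IsAdmissible n k₁ k₂) {p : FibredProduct n}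
    (hp : p ∈ XTilde n k₁ k₂) :
    ∑ i, Real.exp (-(4 * Real.pi ^ 2 * rho₂ n k₁ k₂ ^ 2 * weight k₁ k₂ p i)) = 1 := by
  have h1 : ∀ i, Real.exp (-(4 * Real.pi ^ 2 * rho₂ n k₁ k₂ ^ 2 * weight k₁ k₂ p i))
      = p.r i ^ 2 / rho₁ k₁ ^ 2 := fun i => by
    rw [← div_pow, ← exp_neg_weight h, ← Real.exp_nat_mul]
    congr 1
    push_cast
    ring
  simp only [h1]
  rw [← Finset.sum_div, sum_r_sq h hp]
  exact div_self (pow_pos h.rho₁_pos 2).ne'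

/-- Points of `𝕏̃` with prescribed weights and angular coordinates. -/
theorem exists_mem_XTilde {n : ℕ} {k₁ k₂ : ℝ} (h : IsAdmissible n k₁ k₂)
    (a : Fin (n + 1) → ℝ) (η : Torus (n + 1)) (hη : ∑ i, η i = 0) (ha : ∑ i, a i = 1)
    (hexp : ∑ i, Real.exp (-(4 * Real.pi ^ 2 * rho₂ n k₁ k₂ ^ 2 * a i)) = 1) :
    ∃ p : XTilde n k₁ k₂, p.1.eta = η ∧ ∀ i, weight k₁ k₂ p.1 i = a i := by
  have h1 := h.rho₁_pos
  have h2 := h.rho₂_pos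
  have hπ := Real.pi_pos
  have hρ2sq : rho₂ n k₁ k₂ ^ 2
      = ((n : ℝ) + 1) / (4 * Real.pi ^ 2) * Real.log (-k₁ / Real.pi) + k₂ / Real.pi :=
    Real.sq_sqrt h.rho₂_arg_pos.le
  have hρ1sq : rho₁ k₁ ^ 2 = -k₁ / Real.pi := Real.sq_sqrt h.neg.le
  refine ⟨⟨⟨0, fun i => rho₁ k₁ * Real.exp (-(2 * Real.pi ^ 2 * rho₂ n k₁ k₂ ^ 2 * a i)), η,
    fun i => by positivity⟩, zero_mem _, mem_range_fTranspose.2 hη, ?_, ?_⟩, rfl, fun i => ?_⟩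
  · have e1 : ∀ i, (rho₁ k₁ * Real.exp (-(2 * Real.pi ^ 2 * rho₂ n k₁ k₂ ^ 2 * a i))) ^ 2
        = rho₁ k₁ ^ 2 * Real.exp (-(4 * Real.pi ^ 2 * rho₂ n k₁ k₂ ^ 2 * a i)) := fun i => by
      rw [mul_pow, ← Real.exp_nat_mul]
      congr 2
      push_cast
      ring
    simp only [mu₁, e1]
    rw [← Finset.mul_sum, hexp, hρ1sq]
    field_simp
  · have e2 : Real.log (-k₁ / Real.pi) = 2 * Real.log (rho₁ k₁) := by
      rw [← hρ1sq, Real.log_pow]; norm_num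
    simp only [mu₂]
    have e3 : ∀ i, Real.log (rho₁ k₁ * Real.exp (-(2 * Real.pi ^ 2 * rho₂ n k₁ k₂ ^ 2 * a i)))
        = Real.log (rho₁ k₁) - 2 * Real.pi ^ 2 * rho₂ n k₁ k₂ ^ 2 * a i := fun i => by
      rw [Real.log_mul h1.ne' (Real.exp_pos _).ne', Real.log_exp, sub_eq_add_neg]
    rw [Real.log_prod (fun i _ => by positivity), Finset.sum_congr rfl fun i _ => e3 i,
      Finset.sum_sub_distrib, ← Finset.mul_sum, ha, hρ2sq, e2]
    simp
    field_simp
    ring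
  · have : rho₁ k₁ / (rho₁ k₁ * Real.exp (-(2 * Real.pi ^ 2 * rho₂ n k₁ k₂ ^ 2 * a i)))
        = Real.exp (2 * Real.pi ^ 2 * rho₂ n k₁ k₂ ^ 2 * a i) := by
      rw [Real.exp_neg]; field_simp
    simp only [weight]
    rw [this, Real.log_exp]
    field_simp

/-! ### The fibres of `π₂` -/

theorem piTwo_mk {n : ℕ} {k₁ k₂ : ℝ} (h : IsAdmissible n k₁ k₂) (p : XTilde n k₁ k₂) :
    piTwo h (X.mk p) = H.mk ⟨piTwoVec k₁ k₂ p.1, by simp [norm_piTwoVec h p.1 p.2]⟩ := rfl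

theorem piTwo_mk_congr {n : ℕ} {k₁ k₂ : ℝ} (h : IsAdmissible n k₁ k₂) {p q : XTilde n k₁ k₂}
    (hr : p.1.r = q.1.r) (hη : p.1.eta = q.1.eta) : piTwo h (X.mk p) = piTwo h (X.mk q) := by
  have : piTwoVec k₁ k₂ p.1 = piTwoVec k₁ k₂ q.1 := by simp only [piTwoVec, hr, hη]
  simp only [piTwo_mk, this]

/-- A vanishing weight would contribute exp 0 = 1, the whole sum in `sum_exp_weight`, and for n ≥ 1
another positive term remains. So the image avoids the divisor and the angles can be recovered from
the coordinates. -/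
theorem weight_pos {n : ℕ} (hn : 1 ≤ n) {k₁ k₂ : ℝ} (h : IsAdmissible n k₁ k₂)
    {p : FibredProduct n} (hp : p ∈ XTilde n k₁ k₂) (i : Fin (n + 1)) : 0 < weight k₁ k₂ p i := by
  refine lt_of_le_of_ne (weight_nonneg h hp i) fun h0 => ?_
  have : Nontrivial (Fin (n + 1)) := Fin.nontrivial_iff_two_le.2 (by omega)
  obtain ⟨j, hj⟩ := exists_ne i
  have h1 := sum_exp_weight h hp
  have h2 : ∑ k ∈ {i, j}, Real.exp (-(4 * Real.pi ^ 2 * rho₂ n k₁ k₂ ^ 2 * weight k₁ k₂ p k)) ≤ 1 := by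
    rw [← h1]
    exact Finset.sum_le_sum_of_subset_of_nonneg (Finset.subset_univ _)
      fun _ _ _ => (Real.exp_pos _).le
  rw [Finset.sum_pair hj.symm, ← h0] at h2
  simp only [mul_zero, neg_zero, Real.exp_zero] at h2
  linarith [Real.exp_pos (-(4 * Real.pi ^ 2 * rho₂ n k₁ k₂ ^ 2 * weight k₁ k₂ p j))]

theorem eq_of_mul_toCircle_eq {a b : ℝ} (ha : 0 < a) (hb : 0 ≤ b) {s t : UnitAddCircle}
    (h : (a : ℂ) * (AddCircle.toCircle s : ℂ) = b * (AddCircle.toCircle t : ℂ)) :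
    a = b ∧ s = t := by
  have h1 : a = b := by
    have := congrArg norm h
    rwa [norm_mul, norm_mul, Circle.norm_coe, Circle.norm_coe, mul_one, mul_one,
      Complex.norm_real, Complex.norm_real, Real.norm_eq_abs, Real.norm_eq_abs, abs_of_pos ha,
      abs_of_nonneg hb] at this
  subst h1
  refine ⟨rfl, AddCircle.injective_toCircle one_ne_zero (Circle.ext ?_)⟩
  exact mul_left_cancel₀ (by exact_mod_cast ha.ne') h

/-- Two points of one fibre thus differ, up to the action of `DDual n`, only in θ. The moduli
determine r; the angles differ by an element of `NDual n`, and the constraint on η puts it in the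
range of `fTranspose n` as well. -/
theorem of_piTwo_mk_eq {n : ℕ} (hn : 1 ≤ n) {k₁ k₂ : ℝ} (h : IsAdmissible n k₁ k₂)
    {p q : XTilde n k₁ k₂} (hpq : piTwo h (X.mk p) = piTwo h (X.mk q)) :
    q.1.r = p.1.r ∧ q.1.eta - p.1.eta ∈ DDual n := by
  rw [piTwo_mk, piTwo_mk] at hpq
  obtain ⟨t, ht, hz⟩ := Quotient.exact hpq
  have key : ∀ i, Real.sqrt (weight k₁ k₂ q.1 i) = Real.sqrt (weight k₁ k₂ p.1 i) ∧
      -q.1.eta i = t i + -p.1.eta i := fun i => by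
    have := hz i
    simp only [piTwoVec_apply] at this
    rw [mul_left_comm, ← Circle.coe_mul, ← AddCircle.toCircle_add] at this
    exact eq_of_mul_toCircle_eq (Real.sqrt_pos.2 (weight_pos hn h q.2 i)) (Real.sqrt_nonneg _) this
  refine ⟨funext fun i => ?_, ?_, (fTranspose n).range.sub_mem q.2.2.1 p.2.2.1⟩
  · have h1 : weight k₁ k₂ q.1 i = weight k₁ k₂ p.1 i :=
      (Real.sqrt_inj (weight_nonneg h q.2 i) (weight_nonneg h p.2 i)).1 (key i).1
    have h2 := exp_neg_weight h q.1 i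
    rw [h1, exp_neg_weight h p.1 i] at h2
    exact ((div_left_inj' h.rho₁_pos.ne').1 h2).symm
  · have : q.1.eta - p.1.eta = -t := by
      ext i
      have := (key i).2
      simp only [Pi.sub_apply, Pi.neg_apply]
      rw [sub_eq_iff_eq_add, ← neg_inj, this]
      abel
    rw [this]
    exact (NDual n).neg_mem ht

/-! ### Translating curves along the fibres -/

/-- Minkowski's inequality, from Cauchy–Schwarz, for a velocity perturbed in the θ directions only;
A and C are the untouched radial and η terms. -/
theorem sqrt_sum_add_sq_le {ι : Type*} (s : Finset ι) (A C w a b : ι → ℝ) {B : ℝ}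
    (hA : ∀ i, 0 ≤ A i) (hC : ∀ i, 0 ≤ C i) (hB : 0 ≤ B)
    (hb : ∑ i ∈ s, (w i * b i) ^ 2 ≤ B ^ 2) :
    Real.sqrt (∑ i ∈ s, (A i + (w i * (a i + b i)) ^ 2 + C i))
      ≤ Real.sqrt (∑ i ∈ s, (A i + (w i * a i) ^ 2 + C i)) + B := by
  set S := ∑ i ∈ s, (A i + (w i * a i) ^ 2 + C i) with hS
  have hS0 : 0 ≤ S := Finset.sum_nonneg fun i _ => by
    have := hA i; have := hC i; positivity
  have ha : ∑ i ∈ s, (w i * a i) ^ 2 ≤ S :=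
    Finset.sum_le_sum fun i _ => by linarith [hA i, hC i]
  have hcs := Finset.sum_mul_sq_le_sq_mul_sq s (fun i => w i * a i) (fun i => w i * b i)
  have hcross : ∑ i ∈ s, w i * a i * (w i * b i) ≤ Real.sqrt S * B := by
    refine le_of_sq_le_sq ?_ (by positivity)
    rw [mul_pow, Real.sq_sqrt hS0]
    exact hcs.trans (mul_le_mul ha hb (Finset.sum_nonneg fun i _ => sq_nonneg _) hS0)
  rw [Real.sqrt_le_left (by positivity), add_sq, Real.sq_sqrt hS0]
  have e : ∑ i ∈ s, (A i + (w i * (a i + b i)) ^ 2 + C i)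
      = S + 2 * ∑ i ∈ s, w i * a i * (w i * b i) + ∑ i ∈ s, (w i * b i) ^ 2 := by
    rw [hS, Finset.mul_sum, ← Finset.sum_add_distrib, ← Finset.sum_add_distrib]
    exact Finset.sum_congr rfl fun i _ => by ring
  rw [e]
  linarith

/-- The shift of θ is e₀ + t e₁ for bounded lifts of d₀ and d₁. The constant e₀ costs nothing; e₁
adds the velocity (2π rᵢ e₁ᵢ)ᵢ, which is small because rᵢ ≤ ρ₁. -/
theorem exists_translate {n : ℕ} {k₁ k₂ : ℝ} (h : IsAdmissible n k₁ k₂) (c : XCurve n k₁ k₂)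
    (d₀ d₁ : Torus (n + 1)) (h₀ : ∑ i, d₀ i = 0) (h₁ : ∑ i, d₁ i = 0) :
    ∃ c' : XCurve n k₁ k₂,
      (∀ t, (c'.point t).1.r = (c.point t).1.r ∧ (c'.point t).1.eta = (c.point t).1.eta) ∧
      (c'.point 0).1.theta = (c.point 0).1.theta + d₀ ∧
      (c'.point 1).1.theta = (c.point 1).1.theta + d₀ + d₁ ∧
      c'.length ≤ c.length + ENNReal.ofReal (2 * Real.pi * (n + 1) ^ 2 * rho₁ k₁) := by
  obtain ⟨e₀, he₀, hs₀, -⟩ := exists_lift_sum_eq_zero d₀ h₀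
  obtain ⟨e₁, he₁, hs₁, hb₁⟩ := exists_lift_sum_eq_zero d₁ h₁
  have hsum : ∀ t : unitInterval,
      ∑ i, ((c.point t).1.theta i + ((e₀ i + t * e₁ i : ℝ) : UnitAddCircle)) = 0 := fun t => by
    rw [Finset.sum_add_distrib, ← coe_sum_unitAddCircle, Finset.sum_add_distrib, ← Finset.mul_sum,
      hs₀, hs₁, mem_range_fDualTranspose.1 (c.point t).2.1]
    simp
  have hd : ∀ i t, DifferentiableAt ℝ (fun s => c.theta s i) t := fun i t =>
    ((contDiff_pi.1 c.contDiff_theta i).differentiable one_ne_zero) t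
  refine ⟨{
    theta := fun t i => c.theta t i + (e₀ i + t * e₁ i)
    r := c.r
    eta := c.eta
    contDiff_theta := by
      refine contDiff_pi.2 fun i => (contDiff_pi.1 c.contDiff_theta i).add ?_
      fun_prop
    contDiff_r := c.contDiff_r
    contDiff_eta := c.contDiff_eta
    point := fun t => ⟨⟨fun i => (c.point t).1.theta i + ((e₀ i + t * e₁ i : ℝ) : UnitAddCircle),
      (c.point t).1.r, (c.point t).1.eta, (c.point t).1.r_pos⟩,
      ⟨mem_range_fDualTranspose.2 (hsum t), (c.point t).2.2⟩⟩
    point_theta := fun t i => by simp only [AddCircle.coe_add, c.point_theta]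
    point_r := c.point_r
    point_eta := c.point_eta }, fun t => ⟨rfl, rfl⟩, ?_, ?_, ?_⟩
  · ext i
    simp [he₀]
  · ext i
    simp [he₀, he₁, add_assoc]
  · have hπ := Real.pi_pos
    have hρ := h.rho₁_pos
    have hpt : ∀ t ∈ Set.Icc (0 : ℝ) 1,
        ENNReal.ofReal (Real.sqrt (∑ i, (deriv (fun s => c.r s i) t ^ 2
          + 4 * Real.pi ^ 2 * c.r t i ^ 2
            * deriv (fun s => c.theta s i + (e₀ i + s * e₁ i)) t ^ 2
          + 1 / (4 * Real.pi ^ 2 * c.r t i ^ 2) * deriv (fun s => c.eta s i) t ^ 2)))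
        ≤ ENNReal.ofReal (Real.sqrt (∑ i, (deriv (fun s => c.r s i) t ^ 2
          + 4 * Real.pi ^ 2 * c.r t i ^ 2 * deriv (fun s => c.theta s i) t ^ 2
          + 1 / (4 * Real.pi ^ 2 * c.r t i ^ 2) * deriv (fun s => c.eta s i) t ^ 2)))
          + ENNReal.ofReal (2 * Real.pi * (n + 1) ^ 2 * rho₁ k₁) := fun t ht => by
      rw [← ENNReal.ofReal_add (Real.sqrt_nonneg _) (by positivity)]
      refine ENNReal.ofReal_le_ofReal ?_
      have hder : ∀ i, deriv (fun s => c.theta s i + (e₀ i + s * e₁ i)) t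
          = deriv (fun s => c.theta s i) t + e₁ i := fun i => by
        have h2 : HasDerivAt (fun s : ℝ => e₀ i + s * e₁ i) (e₁ i) t := by
          simpa using ((hasDerivAt_id t).mul_const (e₁ i)).const_add (e₀ i)
        exact ((hd i t).hasDerivAt.add h2).deriv
      have hr : ∀ i, 0 < c.r t i ∧ c.r t i ≤ rho₁ k₁ := fun i => by
        rw [← c.point_r ⟨t, ht⟩ i]
        exact ⟨(c.point ⟨t, ht⟩).1.r_pos i, r_le_rho₁ h (c.point ⟨t, ht⟩).2 i⟩
      have := sqrt_sum_add_sq_le Finset.univ (fun i => deriv (fun s => c.r s i) t ^ 2)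
        (fun i => 1 / (4 * Real.pi ^ 2 * c.r t i ^ 2) * deriv (fun s => c.eta s i) t ^ 2)
        (fun i => 2 * Real.pi * c.r t i) (fun i => deriv (fun s => c.theta s i) t) e₁
        (B := 2 * Real.pi * (n + 1) ^ 2 * rho₁ k₁)
        (fun i => sq_nonneg _) (fun i => by positivity) (by positivity) ?_
      · simp only [hder]
        convert this using 7 <;> ring
      · calc ∑ i, (2 * Real.pi * c.r t i * e₁ i) ^ 2
            ≤ ∑ _i : Fin (n + 1), (2 * Real.pi * rho₁ k₁ * (n + 1)) ^ 2 := by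
              refine Finset.sum_le_sum fun i _ => ?_
              rw [mul_pow, mul_pow (2 * Real.pi * rho₁ k₁)]
              have h3 := hr i
              refine mul_le_mul ?_ (sq_le_sq.2 ?_) (sq_nonneg _) (sq_nonneg _)
              · refine pow_le_pow_left₀ (by have := h3.1; positivity) ?_ 2
                exact mul_le_mul_of_nonneg_left h3.2 (by positivity)
              · rw [abs_of_nonneg (by positivity : (0 : ℝ) ≤ n + 1)]
                exact hb₁ i
          _ = (n + 1) ^ 3 * (2 * Real.pi * rho₁ k₁) ^ 2 := by simp; ring
          -- The exponent 3 is raised to 4 only to obtain a perfect square.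
          _ ≤ (n + 1) ^ 4 * (2 * Real.pi * rho₁ k₁) ^ 2 := by
              refine mul_le_mul_of_nonneg_right ?_ (sq_nonneg _)
              exact pow_le_pow_right₀ (by simp) (by norm_num)
          _ = (2 * Real.pi * (n + 1) ^ 2 * rho₁ k₁) ^ 2 := by ring
    calc _ ≤ ∫⁻ t in Set.Icc (0 : ℝ) 1, (ENNReal.ofReal (Real.sqrt (∑ i,
            (deriv (fun s => c.r s i) t ^ 2
          + 4 * Real.pi ^ 2 * c.r t i ^ 2 * deriv (fun s => c.theta s i) t ^ 2
          + 1 / (4 * Real.pi ^ 2 * c.r t i ^ 2) * deriv (fun s => c.eta s i) t ^ 2)))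
          + ENNReal.ofReal (2 * Real.pi * (n + 1) ^ 2 * rho₁ k₁)) :=
          MeasureTheory.setLIntegral_mono' measurableSet_Icc hpt
      _ = _ := by
          rw [MeasureTheory.lintegral_add_right _ measurable_const]
          simp [XCurve.length]

theorem X.mk_eq {n : ℕ} {k₁ k₂ : ℝ} {p q : XTilde n k₁ k₂} (hθ : p.1.theta = q.1.theta)
    (hr : q.1.r = p.1.r) (hη : q.1.eta - p.1.eta ∈ DDual n) : X.mk p = X.mk q :=
  Quotient.sound ⟨by rw [hθ, sub_self]; exact zero_mem _, hr, hη⟩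

theorem exists_const_curve {n : ℕ} {k₁ k₂ : ℝ} (p : XTilde n k₁ k₂) :
    ∃ c : XCurve n k₁ k₂, (∀ t, c.point t = p) ∧ c.length = 0 := by
  choose θ hθ using fun i => QuotientAddGroup.mk_surjective (p.1.theta i)
  choose η hη using fun i => QuotientAddGroup.mk_surjective (p.1.eta i)
  refine ⟨⟨fun _ => θ, fun _ => p.1.r, fun _ => η, contDiff_const, contDiff_const, contDiff_const,
    fun _ => p, fun _ i => (hθ i).symm, fun _ _ => rfl, fun _ i => (hη i).symm⟩, fun _ => rfl, ?_⟩
  simp [XCurve.length]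

theorem exists_X_mk {n : ℕ} {k₁ k₂ : ℝ} (x : X n k₁ k₂) : ∃ p, X.mk p = x :=
  Quotient.exists_rep x

theorem sum_theta {n : ℕ} {k₁ k₂ : ℝ} (p : XTilde n k₁ k₂) : ∑ i, p.1.theta i = 0 :=
  mem_range_fDualTranspose.1 p.2.1

theorem X.distIn_le {n : ℕ} {k₁ k₂ : ℝ} {A : Set (X n k₁ k₂)} {x y : X n k₁ k₂}
    (c : XCurve n k₁ k₂) (h₀ : X.mk (c.point 0) = x) (h₁ : X.mk (c.point 1) = y)
    (hA : ∀ t, X.mk (c.point t) ∈ A) : X.distIn A x y ≤ c.length :=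
  (iInf_le _ c).trans <| (iInf_le _ h₀).trans <| (iInf_le _ h₁).trans <| iInf_le _ hA

theorem diameter_fibre_le {n : ℕ} (hn : 1 ≤ n) {k₁ k₂ : ℝ} (h : IsAdmissible n k₁ k₂) (p : H n) :
    diameter (X.distIn (piTwo h ⁻¹' {p})) (piTwo h ⁻¹' {p})
      ≤ ENNReal.ofReal (2 * Real.pi * (n + 1) ^ 2 * rho₁ k₁) := by
  refine iSup₂_le fun x hx => iSup₂_le fun y hy => ?_
  obtain ⟨a, rfl⟩ := exists_X_mk x
  obtain ⟨b, rfl⟩ := exists_X_mk y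
  obtain ⟨c, hc, hc0⟩ := exists_const_curve a
  obtain ⟨c', h1, h2, h3, h4⟩ := exists_translate h c 0 (b.1.theta - a.1.theta) (by simp)
    (by simp [Finset.sum_sub_distrib, sum_theta])
  simp only [hc] at h1 h2 h3
  rw [hc0, zero_add] at h4
  have hab := of_piTwo_mk_eq hn h (hx.trans hy.symm)
  refine (X.distIn_le c' ?_ ?_ ?_).trans h4
  · exact X.mk_eq (by simpa using h2) (h1 0).1.symm
      (by rw [(h1 0).2, sub_self]; exact zero_mem _)
  · refine X.mk_eq (by rw [h3]; simp) (by rw [hab.1, (h1 1).1]) (by rw [(h1 1).2]; exact hab.2)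
  · exact fun t => (piTwo_mk_congr h (h1 t).1 (h1 t).2).trans hx

/-- A curve between the two fibres is translated so that it starts at x and ends at y: d₀ corrects
the initial θ, and d₁ what is then still missing at the end. -/
theorem dist_le_fibreDist_add {n : ℕ} (hn : 1 ≤ n) {k₁ k₂ : ℝ} (h : IsAdmissible n k₁ k₂)
    (x y : X n k₁ k₂) : X.dist x y ≤ fibreDist h (piTwo h x) (piTwo h y)
      + ENNReal.ofReal (2 * Real.pi * (n + 1) ^ 2 * rho₁ k₁) := by
  -- The constant goes to the left so that the right side is a bare infimum over curves.
  rw [← tsub_le_iff_right]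
  refine le_iInf fun x' => le_iInf fun y' => le_iInf fun hx => le_iInf fun hy =>
    le_iInf fun c => le_iInf fun hc₀ => le_iInf fun hc₁ => le_iInf fun _ => ?_
  rw [tsub_le_iff_right]
  obtain ⟨a, rfl⟩ := exists_X_mk x
  obtain ⟨b, rfl⟩ := exists_X_mk y
  subst hc₀ hc₁
  have ha := of_piTwo_mk_eq hn h hx
  have hb := of_piTwo_mk_eq hn h hy
  obtain ⟨c', h1, h2, h3, h4⟩ := exists_translate h c (a.1.theta - (c.point 0).1.theta)
    (b.1.theta - (c.point 1).1.theta - (a.1.theta - (c.point 0).1.theta))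
    (by simp [Finset.sum_sub_distrib, sum_theta]) (by simp [Finset.sum_sub_distrib, sum_theta])
  refine (X.distIn_le c' ?_ ?_ fun _ => Set.mem_univ _).trans h4
  · exact X.mk_eq (by rw [h2]; abel) (by rw [ha.1, (h1 0).1]) (by rw [(h1 0).2]; exact ha.2)
  · exact X.mk_eq (by rw [h3]; abel) (by rw [hb.1, (h1 1).1]) (by rw [(h1 1).2]; exact hb.2)

theorem gromovHausdorff_le {n : ℕ} (hn : 1 ≤ n) {k₁ k₂ : ℝ} (h : IsAdmissible n k₁ k₂) :
    gromovHausdorff (X.dist (n := n) (k₁ := k₁) (k₂ := k₂))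
      (fun p q : Set.range (piTwo h) => fibreDist h p.1 q.1)
      ≤ ENNReal.ofReal (2 * Real.pi * (n + 1) ^ 2 * rho₁ k₁) / 2 := by
  refine ENNReal.div_le_div_right (sInf_le ?_) 2
  refine ⟨fun x p => piTwo h x = p.1, fun x => ⟨⟨_, x, rfl⟩, rfl⟩, fun p => p.2, ?_⟩
  rintro x ⟨-, -⟩ y ⟨-, -⟩ rfl rfl
  refine ⟨dist_le_fibreDist_add hn h x y, le_add_right ?_⟩
  exact (iInf₂_le x y).trans ((iInf_le _ rfl).trans (iInf_le _ rfl))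

/-! ### Polar coordinates on the sphere -/

/-- The point of the unit sphere with polar coordinates `(r, η)`. -/
noncomputable def polar {n : ℕ} (r η : Fin (n + 1) → ℝ) (hr : ∑ i, r i ^ 2 = 1) : USphere n :=
  ⟨WithLp.toLp 2 fun i => (r i : ℂ) * (AddCircle.toCircle (η i : UnitAddCircle) : ℂ), by
    rw [mem_sphere_zero_iff_norm, EuclideanSpace.norm_eq]
    simp only [norm_mul, Circle.norm_coe, mul_one, Complex.norm_real, Real.norm_eq_abs, sq_abs,
      hr, Real.sqrt_one]⟩

theorem polar_apply {n : ℕ} (r η : Fin (n + 1) → ℝ) (hr : ∑ i, r i ^ 2 = 1) (i : Fin (n + 1)) :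
    (polar r η hr).1 i = (r i : ℂ) * (AddCircle.toCircle (η i : UnitAddCircle) : ℂ) := rfl

theorem exists_polar {n : ℕ} (z : USphere n) :
    ∃ (r η : Fin (n + 1) → ℝ) (hr : ∑ i, r i ^ 2 = 1), (∀ i, 0 ≤ r i) ∧ (∀ i, |η i| ≤ 1) ∧
      polar r η hr = z := by
  have hπ := Real.pi_pos
  have hz : ∑ i, ‖z.1 i‖ ^ 2 = 1 := by
    rw [← EuclideanSpace.norm_sq_eq, mem_sphere_zero_iff_norm.1 z.2]; norm_num
  refine ⟨fun i => ‖z.1 i‖, fun i => Complex.arg (z.1 i) / (2 * Real.pi), hz,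
    fun i => norm_nonneg _, fun i => ?_, ?_⟩
  · rw [abs_div, abs_of_pos (by positivity : 0 < 2 * Real.pi), div_le_one (by positivity)]
    linarith [Complex.abs_arg_le_pi (z.1 i)]
  · refine Subtype.ext (PiLp.ext fun i => ?_)
    rw [polar_apply, AddCircle.toCircle_apply_mk, Circle.coe_exp]
    have : 2 * Real.pi / 1 * (Complex.arg (z.1 i) / (2 * Real.pi)) = Complex.arg (z.1 i) := by
      field_simp
    rw [this]
    exact Complex.norm_mul_exp_arg_mul_I _

theorem mk_polar_sub_const {n : ℕ} (r η : Fin (n + 1) → ℝ) (hr : ∑ i, r i ^ 2 = 1) (t : ℝ) :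
    H.mk (polar r (fun i => η i - t) hr) = H.mk (polar r η hr) := by
  refine Quotient.sound ⟨_, const_mem_NDual n (t : UnitAddCircle), fun i => ?_⟩
  rw [polar_apply, polar_apply, mul_left_comm, ← Circle.coe_mul, ← AddCircle.toCircle_add,
    ← AddCircle.coe_add, add_sub_cancel]

theorem piTwo_mk_eq_polar {n : ℕ} {k₁ k₂ : ℝ} (h : IsAdmissible n k₁ k₂) (p : XTilde n k₁ k₂)
    (r η : Fin (n + 1) → ℝ) (hr : ∑ i, r i ^ 2 = 1)
    (hw : ∀ i, Real.sqrt (weight k₁ k₂ p.1 i) = r i)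
    (hη : ∀ i, -p.1.eta i = (η i : UnitAddCircle)) :
    piTwo h (X.mk p) = H.mk (polar r η hr) := by
  rw [piTwo_mk]
  refine congrArg H.mk (Subtype.ext (PiLp.ext fun i => ?_))
  rw [polar_apply, ← hw, ← hη]
  rfl

theorem sum_sqrt_weight_sq {n : ℕ} {k₁ k₂ : ℝ} (h : IsAdmissible n k₁ k₂) {p : FibredProduct n}
    (hp : p ∈ XTilde n k₁ k₂) : ∑ i, Real.sqrt (weight k₁ k₂ p i) ^ 2 = 1 := by
  rw [← sum_weight h hp]
  exact Finset.sum_congr rfl fun i _ => Real.sq_sqrt (weight_nonneg h hp i)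

theorem exists_piTwo_eq_polar {n : ℕ} {k₁ k₂ : ℝ} (h : IsAdmissible n k₁ k₂)
    (p : XTilde n k₁ k₂) : ∃ η : Fin (n + 1) → ℝ, piTwo h (X.mk p)
      = H.mk (polar (fun i => Real.sqrt (weight k₁ k₂ p.1 i)) η (sum_sqrt_weight_sq h p.2)) := by
  choose η hη using fun i => QuotientAddGroup.mk_surjective (-p.1.eta i)
  exact ⟨η, piTwo_mk_eq_polar h p _ η _ (fun _ => rfl) fun i => (hη i).symm⟩

/-! ### The image of `π₂` is close to the divisor -/

/-- Otherwise each of the n+1 terms would be smaller than 1/(n+1). -/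
theorem exists_le_log_div {n : ℕ} {L : ℝ} (hL : 0 < L) (a : Fin (n + 1) → ℝ)
    (ha : ∑ i, Real.exp (-(L * a i)) = 1) : ∃ i, a i ≤ Real.log (n + 1) / L := by
  by_contra! hcon
  have hn : (0 : ℝ) < n + 1 := by positivity
  have : ∑ i, Real.exp (-(L * a i)) < ∑ _i : Fin (n + 1), ((n : ℝ) + 1)⁻¹ := by
    refine Finset.sum_lt_sum_of_nonempty Finset.univ_nonempty fun i _ => ?_
    have h1 := hcon i
    rw [div_lt_iff₀ hL] at h1
    calc Real.exp (-(L * a i)) < Real.exp (-Real.log (n + 1)) := Real.exp_lt_exp.2 (by linarith)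
      _ = ((n : ℝ) + 1)⁻¹ := by rw [Real.exp_neg, Real.exp_log hn]
  rw [ha] at this
  simp only [Finset.sum_const, Finset.card_univ, Fintype.card_fin, nsmul_eq_mul] at this
  push_cast at this
  rw [mul_inv_cancel₀ hn.ne'] at this
  exact lt_irrefl _ this

theorem exists_segment_weights {n : ℕ} {L : ℝ} (hL : 0 < L)
    (hL' : Real.log (n + 1) < L / (n + 1)) (b : Fin (n + 1) → ℝ) (hb : ∀ i, 0 ≤ b i)
    (hb0 : ∃ i, b i = 0) : ∃ s ∈ Set.Icc (0 : ℝ) 1, s ≤ (n + 1) * Real.log (n + 1) / L ∧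
      ∑ i, Real.exp (-(L * ((1 - s) * b i + s / (n + 1)))) = 1 := by
  have hn : (0 : ℝ) < n + 1 := by positivity
  let g : ℝ → ℝ := fun s => ∑ i, Real.exp (-(L * ((1 - s) * b i + s / (n + 1))))
  have hg : ContinuousOn g (Set.Icc 0 1) := by
    refine Continuous.continuousOn ?_
    fun_prop
  -- At s = 0 the vanishing coordinate alone contributes 1; at s = 1 all coordinates equal 1/(n+1),
  -- and `hL'` makes the sum at most 1.
  have h0 : 1 ≤ g 0 := by
    obtain ⟨i, hi⟩ := hb0
    have : Real.exp (-(L * ((1 - 0) * b i + 0 / (n + 1)))) ≤ g 0 :=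
      Finset.single_le_sum (f := fun i => Real.exp (-(L * ((1 - 0) * b i + 0 / ((n : ℝ) + 1)))))
        (fun _ _ => (Real.exp_pos _).le) (Finset.mem_univ i)
    simpa [hi] using this
  have h1 : g 1 ≤ 1 := by
    have e : g 1 = (n + 1) * Real.exp (-(L / (n + 1))) := by
      simp [g, div_eq_mul_inv]
    rw [e, ← Real.exp_log hn, ← Real.exp_add, Real.exp_log hn, Real.exp_le_one_iff]
    linarith
  obtain ⟨s, hs, hgs⟩ := intermediate_value_Icc' zero_le_one hg ⟨h1, h0⟩
  refine ⟨s, hs, ?_, hgs⟩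
  -- Every coordinate is at least s/(n+1) and one of them is at most log(n+1)/L, which bounds s.
  obtain ⟨i, hi⟩ := exists_le_log_div hL _ hgs
  have : s / (n + 1) ≤ Real.log (n + 1) / L :=
    le_trans (le_add_of_nonneg_left (mul_nonneg (by linarith [hs.2]) (hb i))) hi
  rw [div_le_iff₀ hn] at this
  calc s ≤ _ := this
    _ = _ := by ring

/-- This is the logarithm of the admissibility condition: it places the barycentre on the far side
of the image in `exists_segment_weights`. -/
theorem IsAdmissible.log_lt {n : ℕ} {k₁ k₂ : ℝ} (h : IsAdmissible n k₁ k₂) :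
    Real.log (n + 1) < 4 * Real.pi ^ 2 * rho₂ n k₁ k₂ ^ 2 / (n + 1) := by
  have hπ := Real.pi_pos
  have hn : (0 : ℝ) < n + 1 := by positivity
  have h1 := Real.log_lt_log hn h
  rw [Real.log_mul h.neg.ne' (Real.exp_pos _).ne', Real.log_exp] at h1
  rw [rho₂, Real.sq_sqrt h.rho₂_arg_pos.le]
  convert h1 using 1
  field_simp

/-- Two points of `Hⁿ` with the same angular coordinates, and close radial coordinates. -/
def RadiallyClose {n : ℕ} (s : ℝ) (p q : H n) : Prop :=
  ∃ (r r' η : Fin (n + 1) → ℝ) (hr : ∑ i, r i ^ 2 = 1) (hr' : ∑ i, r' i ^ 2 = 1),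
    (∀ i, 0 ≤ r i) ∧ (∀ i, 0 ≤ r' i) ∧ H.mk (polar r η hr) = p ∧ H.mk (polar r' η hr') = q ∧
      Real.sqrt (1 - s) ≤ ∑ i, r i * r' i

theorem exists_divisor_radiallyClose {n : ℕ} (hn : 1 ≤ n) {k₁ k₂ : ℝ} (h : IsAdmissible n k₁ k₂)
    {p : H n} (hp : p ∈ Set.range (piTwo h)) : ∃ q ∈ H.divisor n,
      RadiallyClose ((n + 1) * Real.log (n + 1) / (4 * Real.pi ^ 2 * rho₂ n k₁ k₂ ^ 2)) p q := by
  obtain ⟨x, rfl⟩ := hp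
  obtain ⟨p, rfl⟩ := exists_X_mk x
  obtain ⟨η, hη⟩ := exists_piTwo_eq_polar h p
  have hπ := Real.pi_pos
  have hρ := h.rho₂_pos
  have hL : 0 < 4 * Real.pi ^ 2 * rho₂ n k₁ k₂ ^ 2 := by positivity
  obtain ⟨i, hi⟩ := exists_le_log_div hL _ (sum_exp_weight h p.2)
  have hpos := weight_pos hn h p.2
  have hsum := sum_weight h p.2
  set a := weight k₁ k₂ p.1 with ha
  have hrest : ∑ j ∈ Finset.univ.erase i, a j = 1 - a i := by
    rw [← hsum, ← Finset.add_sum_erase _ _ (Finset.mem_univ i)]; ring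
  have hai : 0 < 1 - a i := by
    rw [← hrest]
    have : Nontrivial (Fin (n + 1)) := Fin.nontrivial_iff_two_le.2 (by omega)
    obtain ⟨j, hj⟩ := exists_ne i
    exact Finset.sum_pos (fun j _ => hpos j) ⟨j, by simp [hj]⟩
  -- The smallest coordinate is deleted and the rest renormalized; the inner product with the
  -- original vector is then exactly √(1 - aᵢ).
  let r' : Fin (n + 1) → ℝ := fun j => if j = i then 0 else Real.sqrt (a j) / Real.sqrt (1 - a i)
  have hr' : ∑ j, r' j ^ 2 = 1 := by
    rw [← Finset.add_sum_erase _ _ (Finset.mem_univ i)]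
    have : ∀ j ∈ Finset.univ.erase i, r' j ^ 2 = a j / (1 - a i) := fun j hj => by
      simp only [r', if_neg (Finset.ne_of_mem_erase hj)]
      rw [div_pow, Real.sq_sqrt (hpos j).le, Real.sq_sqrt hai.le]
    rw [Finset.sum_congr rfl this, ← Finset.sum_div, hrest, div_self hai.ne']
    simp [r']
  refine ⟨H.mk (polar r' η hr'), ⟨_, rfl, ?_⟩, fun j => Real.sqrt (a j), r', η,
    sum_sqrt_weight_sq h p.2, hr', fun j => Real.sqrt_nonneg _, fun j => ?_, hη.symm, rfl, ?_⟩
  · exact Finset.prod_eq_zero (Finset.mem_univ i) (by simp [polar_apply, r'])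
  · simp only [r']
    split_ifs
    · exact le_rfl
    · positivity
  · rw [← Finset.add_sum_erase _ _ (Finset.mem_univ i)]
    have : ∀ j ∈ Finset.univ.erase i, Real.sqrt (a j) * r' j = a j / Real.sqrt (1 - a i) :=
      fun j hj => by
        simp only [r', if_neg (Finset.ne_of_mem_erase hj)]
        rw [← mul_div_assoc, Real.mul_self_sqrt (hpos j).le]
    rw [Finset.sum_congr rfl this, ← Finset.sum_div, hrest, Real.div_sqrt]
    simp only [r', if_pos, mul_zero, zero_add]
    refine Real.sqrt_le_sqrt (sub_le_sub_left (hi.trans ?_) 1)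
    rw [mul_div_assoc]
    have h0 : 0 ≤ Real.log ((n : ℝ) + 1) / (4 * Real.pi ^ 2 * rho₂ n k₁ k₂ ^ 2) :=
      div_nonneg (Real.log_nonneg (by simp)) hL.le
    exact le_mul_of_one_le_left h0 (by simp)

theorem exists_range_radiallyClose {n : ℕ} {k₁ k₂ : ℝ} (h : IsAdmissible n k₁ k₂)
    {q : H n} (hq : q ∈ H.divisor n) : ∃ p ∈ Set.range (piTwo h),
      RadiallyClose ((n + 1) * Real.log (n + 1) / (4 * Real.pi ^ 2 * rho₂ n k₁ k₂ ^ 2)) p q := by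
  obtain ⟨z, rfl, hz⟩ := hq
  obtain ⟨b, η₀, hb, hb0, -, rfl⟩ := exists_polar z
  have hπ := Real.pi_pos
  have hρ := h.rho₂_pos
  have hn : (0 : ℝ) < n + 1 := by positivity
  have hzero : ∃ i, b i ^ 2 = 0 := by
    obtain ⟨i, -, hi⟩ := Finset.prod_eq_zero_iff.1 hz
    refine ⟨i, ?_⟩
    rw [polar_apply, mul_eq_zero] at hi
    have : b i = 0 := by simpa using hi
    simp [this]
  obtain ⟨s, hs, hsle, hexp⟩ := exists_segment_weights
    (L := 4 * Real.pi ^ 2 * rho₂ n k₁ k₂ ^ 2) (by positivity) h.log_lt (fun i => b i ^ 2)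
    (fun i => sq_nonneg _) hzero
  have ha : ∑ i, ((1 - s) * b i ^ 2 + s / (n + 1)) = 1 := by
    rw [Finset.sum_add_distrib, ← Finset.mul_sum, hb]
    simp
    field_simp
    ring
  have ha0 : ∀ i, 0 ≤ (1 - s) * b i ^ 2 + s / (n + 1) := fun i =>
    add_nonneg (mul_nonneg (by linarith [hs.2]) (sq_nonneg _)) (div_nonneg hs.1 hn.le)
  -- Subtracting the mean meets the constraint ∑ η = 0 and, since the diagonal circle lies in `NDual
  -- n`, does not move the point of `H n`.
  let η : Fin (n + 1) → ℝ := fun i => η₀ i - (∑ j, η₀ j) / (n + 1)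
  have hη : ∑ i, η i = 0 := by
    simp only [η, Finset.sum_sub_distrib, Finset.sum_const, Finset.card_univ, Fintype.card_fin,
      nsmul_eq_mul]
    push_cast
    field_simp
    ring
  obtain ⟨p, hp, hpw⟩ := exists_mem_XTilde h _ (fun i => -(η i : UnitAddCircle))
    (by rw [Finset.sum_neg_distrib, ← coe_sum_unitAddCircle, hη]; simp) ha hexp
  have hr : ∑ i, Real.sqrt ((1 - s) * b i ^ 2 + s / (n + 1)) ^ 2 = 1 := by
    refine Eq.trans ?_ ha
    exact Finset.sum_congr rfl fun i _ => Real.sq_sqrt (ha0 i)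
  refine ⟨_, ⟨X.mk p, rfl⟩, fun i => Real.sqrt ((1 - s) * b i ^ 2 + s / (n + 1)), b, η, hr, hb,
    fun i => Real.sqrt_nonneg _, hb0, ?_, mk_polar_sub_const b η₀ hb _, ?_⟩
  · exact (piTwo_mk_eq_polar h p _ η hr (fun i => by rw [hpw]) fun i => by simp [hp]).symm
  · calc Real.sqrt (1 - _) ≤ Real.sqrt (1 - s) := Real.sqrt_le_sqrt (by linarith)
      _ = ∑ i, Real.sqrt (1 - s) * b i * b i := by
          have : ∑ i, Real.sqrt (1 - s) * b i * b i = Real.sqrt (1 - s) * ∑ i, b i ^ 2 := by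
            rw [Finset.mul_sum]
            exact Finset.sum_congr rfl fun i _ => by ring
          rw [this, hb, mul_one]
      _ ≤ _ := by
          refine Finset.sum_le_sum fun i _ => mul_le_mul_of_nonneg_right ?_ (hb0 i)
          refine Real.le_sqrt_of_sq_le ?_
          rw [mul_pow, Real.sq_sqrt (by linarith [hs.2])]
          exact le_add_of_nonneg_right (div_nonneg hs.1 hn.le)

/-! ### From radial closeness to Hausdorff distance -/

theorem hausdorff_le {α : Type*} {d : α → α → ℝ≥0∞} {A B : Set α} {δ : ℝ≥0∞}
    (hA : ∀ a ∈ A, ∃ b ∈ B, d a b ≤ δ) (hB : ∀ b ∈ B, ∃ a ∈ A, d b a ≤ δ) :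
    hausdorff d A B ≤ δ := by
  refine max_le (iSup₂_le fun a ha => ?_) (iSup₂_le fun b hb => ?_)
  · obtain ⟨b, hb, h⟩ := hA a ha
    exact (iInf₂_le b hb).trans h
  · obtain ⟨a, ha, h⟩ := hB b hb
    exact (iInf₂_le a ha).trans h

theorem RadiallyClose.symm {n : ℕ} {s : ℝ} {p q : H n} (h : RadiallyClose s p q) :
    RadiallyClose s q p := by
  obtain ⟨r, r', η, hr, hr', h0, h0', hp, hq, hs⟩ := h
  exact ⟨r', r, η, hr', hr, h0', h0, hq, hp, by simpa only [mul_comm] using hs⟩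

theorem hausdorff_le_of_radiallyClose {n : ℕ} (hn : 1 ≤ n) {k₁ k₂ : ℝ} (h : IsAdmissible n k₁ k₂)
    {d : H n → H n → ℝ≥0∞} {δ : ℝ≥0∞} (hd : ∀ p q, RadiallyClose
      ((n + 1) * Real.log (n + 1) / (4 * Real.pi ^ 2 * rho₂ n k₁ k₂ ^ 2)) p q → d p q ≤ δ) :
    hausdorff d (Set.range (piTwo h)) (H.divisor n) ≤ δ := by
  refine hausdorff_le (fun p hp => ?_) fun q hq => ?_
  · obtain ⟨q, hq, hpq⟩ := exists_divisor_radiallyClose hn h hp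
    exact ⟨q, hq, hd _ _ hpq⟩
  · obtain ⟨p, hp, hpq⟩ := exists_range_radiallyClose h hq
    exact ⟨p, hp, hd _ _ hpq.symm⟩

theorem RadiallyClose.fubiniStudy_le {n : ℕ} {s : ℝ} {p q : H n} (h : RadiallyClose s p q) :
    H.fubiniStudy p q ≤ ENNReal.ofReal (Real.arccos (Real.sqrt (1 - s))) := by
  obtain ⟨r, r', η, hr, hr', h0, h0', hp, hq, hs⟩ := h
  refine (iInf₂_le (polar r η hr) (polar r' η hr')).trans
    ((iInf_le _ hp).trans ((iInf_le _ hq).trans (ENNReal.ofReal_le_ofReal ?_)))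
  refine Real.antitone_arccos (hs.trans (le_of_eq ?_))
  have : inner ℂ (polar r η hr).1 (polar r' η hr').1 = ((∑ i, r i * r' i : ℝ) : ℂ) := by
    rw [PiLp.inner_apply, Complex.ofReal_sum]
    refine Finset.sum_congr rfl fun i _ => ?_
    rw [polar_apply, polar_apply, RCLike.inner_apply, map_mul, Complex.conj_ofReal]
    have h1 : (AddCircle.toCircle (η i : UnitAddCircle) : ℂ)
        * (starRingEnd ℂ) (AddCircle.toCircle (η i : UnitAddCircle) : ℂ) = 1 := by
      rw [Complex.mul_conj, Circle.normSq_coe, Complex.ofReal_one]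
    rw [mul_mul_mul_comm, mul_comm (r' i : ℂ)]
    push_cast
    rw [h1, mul_one]
  rw [this, Complex.norm_real, Real.norm_eq_abs,
    abs_of_nonneg (Finset.sum_nonneg fun i _ => mul_nonneg (h0 i) (h0' i))]

/-! ### Curves on the positive part of the sphere -/

/-- A bound for the speed of the curves of `exists_radial_curve`. -/
noncomputable def radialSpeed (n : ℕ) : ℝ := 16 + 576 * (n + 1)

theorem radialSpeed_pos (n : ℕ) : 0 < radialSpeed n := by
  unfold radialSpeed; positivity

theorem exists_unit_parameter : ∃ τ τ' : ℝ → ℝ, ContDiff ℝ 1 τ ∧ (∀ t, HasDerivAt τ (τ' t) t) ∧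
    τ 0 = 0 ∧ τ 1 = 1 ∧ (∀ t, 0 ≤ τ t ∧ τ t ≤ 1) ∧ (∀ t ∈ Set.Ioo (0 : ℝ) 1, 0 < τ t ∧ τ t < 1) ∧
    ∀ t, |τ' t| ≤ 4 := by
  -- The cosine profile stays in [0,1] for every real t, so curves built from it are smooth and
  -- nonnegative on all of ℝ.
  have hπ := Real.pi_pos
  refine ⟨fun t => (1 - Real.cos (Real.pi * t)) / 2, fun t => Real.sin (Real.pi * t) * Real.pi / 2,
    by fun_prop, fun t => ?_, by simp, by norm_num, fun t => ?_, fun t ht => ?_, fun t => ?_⟩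
  · have h1 : HasDerivAt (fun t : ℝ => Real.pi * t) Real.pi t := by
      simpa using (hasDerivAt_id t).const_mul Real.pi
    exact ((h1.cos.const_sub 1).div_const 2).congr_deriv (by ring)
  · constructor <;> linarith [Real.neg_one_le_cos (Real.pi * t), Real.cos_le_one (Real.pi * t)]
  · have h0 : 0 < Real.pi * t := mul_pos hπ ht.1
    have h1 : Real.pi * t < Real.pi := mul_lt_of_lt_one_right hπ ht.2
    have h2 := Real.cos_lt_cos_of_nonneg_of_le_pi le_rfl h1.le h0
    have h3 := Real.cos_lt_cos_of_nonneg_of_le_pi h0.le le_rfl h1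
    rw [Real.cos_zero] at h2
    rw [Real.cos_pi] at h3
    constructor <;> linarith
  · rw [abs_div, abs_mul, abs_of_pos hπ, abs_two]
    have := mul_le_mul (Real.abs_sin_le_one (Real.pi * t)) Real.pi_le_four hπ.le zero_le_one
    linarith

theorem exists_radial_curve {n : ℕ} (r r' : Fin (n + 1) → ℝ) (hr : ∑ i, r i ^ 2 = 1)
    (hr' : ∑ i, r' i ^ 2 = 1) (h0 : ∀ i, 0 ≤ r i) (h0' : ∀ i, 0 ≤ r' i) :
    ∃ γ : ℝ → Fin (n + 1) → ℝ, ContDiff ℝ 1 γ ∧ γ 0 = r ∧ γ 1 = r' ∧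
      (∀ t, ∑ i, γ t i ^ 2 = 1) ∧ (∀ t i, 0 ≤ γ t i) ∧
      (∀ t ∈ Set.Ioo (0 : ℝ) 1, ∀ i, 0 < γ t i) ∧
      ∀ t i, |deriv (fun s => γ s i) t| ≤ radialSpeed n := by
  obtain ⟨τ, τ', hτ, hτd, hτ0, hτ1, hτI, hτi, hτb⟩ := exists_unit_parameter
  have hle : ∀ {a : Fin (n + 1) → ℝ}, ∑ i, a i ^ 2 = 1 → ∀ i, a i ≤ 1 := fun {a} ha i => by
    have : a i ^ 2 ≤ 1 := by
      rw [← ha]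
      exact Finset.single_le_sum (f := fun j => a j ^ 2) (fun j _ => sq_nonneg _)
        (Finset.mem_univ i)
    exact (abs_le_one_iff_mul_self_le_one.2 (by nlinarith) |> abs_le.1).2
  -- The segment may run inside a coordinate hyperplane; the bump τ(1-τ) makes every coordinate
  -- positive for 0 < t < 1 without moving the end points. The curve is q/|q|.
  let q : ℝ → Fin (n + 1) → ℝ := fun t i => (1 - τ t) * r i + τ t * r' i + τ t * (1 - τ t)
  let q' : ℝ → Fin (n + 1) → ℝ := fun t i => τ' t * (r' i - r i + 1 - 2 * τ t)
  have hq : ∀ t i, HasDerivAt (fun s => q s i) (q' t i) t := fun t i => by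
    have h1 := ((((hτd t).const_sub 1).mul_const (r i)).add ((hτd t).mul_const (r' i))).add
      ((hτd t).mul ((hτd t).const_sub 1))
    exact h1.congr_deriv (by simp only [q']; ring)
  have hqc : ∀ i, ContDiff ℝ 1 fun t => q t i := fun i => by
    simp only [q]
    fun_prop
  have hq0 : ∀ t i, 0 ≤ q t i := fun t i => by
    have h1 := hτI t
    have h2 : 0 ≤ 1 - τ t := by linarith
    have h3 := h0 i
    have h4 := h0' i
    have h5 := h1.1
    simp only [q]
    positivity
  have hq3 : ∀ t i, q t i ≤ 3 := fun t i => by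
    have h1 := hτI t
    have h2 := hle hr i
    have h3 := hle hr' i
    have h4 := h0 i
    have h5 := h0' i
    simp only [q]
    nlinarith
  have hq8 : ∀ t i, |q' t i| ≤ 8 := fun t i => by
    have h1 := hτI t
    have h2 := hle hr i
    have h3 := hle hr' i
    have h4 := h0 i
    have h5 := h0' i
    have h6 : |r' i - r i + 1 - 2 * τ t| ≤ 2 := by
      rw [abs_le]; constructor <;> linarith
    simp only [q', abs_mul]
    have := mul_le_mul (hτb t) h6 (abs_nonneg _) (by norm_num)
    linarith
  let S : ℝ → ℝ := fun t => ∑ i, q t i ^ 2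
  let S' : ℝ → ℝ := fun t => ∑ i, 2 * q t i * q' t i
  have hS : ∀ t, HasDerivAt S (S' t) t := fun t => by
    have := HasDerivAt.fun_sum (u := Finset.univ) fun i _ => (hq t i).fun_pow 2
    exact this.congr_deriv (by simp [S'])
  have hSc : ContDiff ℝ 1 S := by
    exact ContDiff.sum fun i _ => (hqc i).pow 2
  -- All cross terms are nonnegative, so |q|² ≥ (1-τ)² + τ² ≥ 1/2 and normalizing keeps the speed
  -- bounded.
  have hS2 : ∀ t, 1 / 2 ≤ S t := fun t => by
    have h1 := hτI t
    have h2 : (1 - τ t) ^ 2 + τ t ^ 2 ≤ S t := by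
      calc (1 - τ t) ^ 2 + τ t ^ 2
          = ∑ i, (((1 - τ t) * r i) ^ 2 + (τ t * r' i) ^ 2) := by
            simp only [mul_pow, Finset.sum_add_distrib, ← Finset.mul_sum, hr, hr', mul_one]
        _ ≤ S t := by
            refine Finset.sum_le_sum fun i _ => ?_
            have h3 : 0 ≤ (1 - τ t) * r i := mul_nonneg (by linarith) (h0 i)
            have h4 : 0 ≤ τ t * r' i := mul_nonneg h1.1 (h0' i)
            have h5 : 0 ≤ τ t * (1 - τ t) := mul_nonneg h1.1 (by linarith)
            calc _ ≤ ((1 - τ t) * r i + τ t * r' i) ^ 2 := by nlinarith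
              _ ≤ _ := pow_le_pow_left₀ (by positivity) (by simp only [q]; linarith) 2
    nlinarith [sq_nonneg (2 * τ t - 1)]
  have hSpos : ∀ t, 0 < S t := fun t => lt_of_lt_of_le (by norm_num) (hS2 t)
  have hS' : ∀ t, |S' t| ≤ 48 * (n + 1) := fun t => by
    calc |S' t| ≤ ∑ i, |2 * q t i * q' t i| := Finset.abs_sum_le_sum_abs _ _
      _ ≤ ∑ _i : Fin (n + 1), (48 : ℝ) := by
          refine Finset.sum_le_sum fun i _ => ?_
          rw [abs_mul, abs_mul, abs_two, abs_of_nonneg (hq0 t i)]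
          have := mul_le_mul (hq3 t i) (hq8 t i) (abs_nonneg _) (by norm_num)
          linarith
      _ = 48 * (n + 1) := by simp; ring
  refine ⟨fun t i => q t i / Real.sqrt (S t), contDiff_pi.2 fun i =>
    (hqc i).div (hSc.sqrt fun t => (hSpos t).ne') fun t => (Real.sqrt_pos.2 (hSpos t)).ne',
    ?_, ?_, fun t => ?_, fun t i => div_nonneg (hq0 t i) (Real.sqrt_nonneg _), fun t ht i => ?_,
    fun t i => ?_⟩
  · ext i
    simp [S, q, hτ0, hr]
  · ext i
    simp [S, q, hτ1, hr']
  · simp only [div_pow, Real.sq_sqrt (hSpos t).le]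
    rw [← Finset.sum_div]
    exact div_self (hSpos t).ne'
  · refine div_pos ?_ (Real.sqrt_pos.2 (hSpos t))
    have h1 := hτi t ht
    have h2 : 0 < 1 - τ t := by linarith
    have h3 := h0 i
    have h4 := h0' i
    have h5 := h1.1
    simp only [q]
    positivity
  · have hs : 0 < Real.sqrt (S t) := Real.sqrt_pos.2 (hSpos t)
    have hs2 : 1 / 2 ≤ Real.sqrt (S t) :=
      Real.le_sqrt_of_sq_le (by linarith [hS2 t])
    rw [((hq t i).fun_div ((hS t).sqrt (hSpos t).ne') hs.ne').deriv, Real.sq_sqrt (hSpos t).le,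
      abs_div, abs_of_pos (hSpos t), div_le_iff₀ (hSpos t)]
    have e1 : |q' t i * Real.sqrt (S t)| ≤ 16 * S t := by
      rw [abs_mul, abs_of_pos hs]
      have h1 : Real.sqrt (S t) ≤ 2 * S t := by
        nlinarith [Real.mul_self_sqrt (hSpos t).le]
      have := mul_le_mul (hq8 t i) h1 hs.le (by norm_num)
      linarith
    have e2 : |q t i * (S' t / (2 * Real.sqrt (S t)))| ≤ 576 * (n + 1) * S t := by
      rw [abs_mul, abs_div, abs_of_nonneg (hq0 t i), abs_of_pos (by positivity : 0 < 2 * √(S t))]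
      have h1 : |S' t| / (2 * Real.sqrt (S t)) ≤ 48 * (n + 1) := by
        rw [div_le_iff₀ (by positivity)]
        calc |S' t| ≤ 48 * (n + 1) * 1 := by rw [mul_one]; exact hS' t
          _ ≤ _ := mul_le_mul_of_nonneg_left (by linarith) (by positivity)
      have h2 := mul_le_mul (hq3 t i) h1 (by positivity) (by norm_num)
      have h3 : (0 : ℝ) ≤ n + 1 := by positivity
      nlinarith [mul_le_mul_of_nonneg_left (hS2 t) h3]
    calc _ ≤ _ := abs_sub _ _
      _ ≤ 16 * S t + 576 * (n + 1) * S t := add_le_add e1 e2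
      _ = radialSpeed n * S t := by rw [radialSpeed]; ring

/-! ### Estimates of the degenerate distance -/

/-- The test curve follows `exists_radial_curve` in the moduli and is linear in the angles. With M =
0 only the radial term, of order ρ₁ρ₂, survives. -/
theorem degenerateDist_polar_le {n : ℕ} {ρ₁ ρ₂ : ℝ} (hρ₁ : 0 < ρ₁) (hρ₂ : 0 < ρ₂)
    (r r' η η' : Fin (n + 1) → ℝ) (hr : ∑ i, r i ^ 2 = 1) (hr' : ∑ i, r' i ^ 2 = 1)
    (h0 : ∀ i, 0 ≤ r i) (h0' : ∀ i, 0 ≤ r' i) {M : ℝ} (hM : ∀ i, |η' i - η i| ≤ M) :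
    H.degenerateDist ρ₁ ρ₂ (H.mk (polar r η hr)) (H.mk (polar r' η' hr'))
      ≤ ENNReal.ofReal (Real.sqrt ((n + 1) * ((2 * Real.pi * ρ₁ * ρ₂ * radialSpeed n) ^ 2
        + Real.exp (4 * Real.pi ^ 2 * ρ₂ ^ 2) / (4 * Real.pi ^ 2 * ρ₁ ^ 2) * M ^ 2))) := by
  have hπ := Real.pi_pos
  obtain ⟨γ, hγ, hγ0, hγ1, hγs, hγn, hγp, hγd⟩ := exists_radial_curve r r' hr hr' h0 h0'
  let c : PolarCurve n :=
    { r := γ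
      eta := fun t i => η i + t * (η' i - η i)
      contDiff_r := hγ
      contDiff_eta := contDiff_pi.2 fun i => by fun_prop
      point := fun t => polar (γ t) (fun i => η i + t * (η' i - η i)) (hγs t)
      point_eq := fun t i => rfl
      r_nonneg := fun t _ => hγn t
      r_pos := hγp }
  have hc0 : H.mk (c.point 0) = H.mk (polar r η hr) := by
    refine congrArg H.mk (Subtype.ext (PiLp.ext fun i => ?_))
    simp [c, polar_apply, hγ0]
  have hc1 : H.mk (c.point 1) = H.mk (polar r' η' hr') := by
    refine congrArg H.mk (Subtype.ext (PiLp.ext fun i => ?_))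
    simp [c, polar_apply, hγ1]
  refine (iInf_le _ c).trans ((iInf_le _ hc0).trans ((iInf_le _ hc1).trans ?_))
  rw [PolarCurve.length]
  refine (MeasureTheory.setLIntegral_mono' (g := fun _ => ENNReal.ofReal (Real.sqrt ((n + 1) *
    ((2 * Real.pi * ρ₁ * ρ₂ * radialSpeed n) ^ 2 + Real.exp (4 * Real.pi ^ 2 * ρ₂ ^ 2)
      / (4 * Real.pi ^ 2 * ρ₁ ^ 2) * M ^ 2)))) measurableSet_Icc fun t _ =>
    ENNReal.ofReal_le_ofReal (Real.sqrt_le_sqrt ?_)).trans (by simp)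
  have hη : ∀ i, deriv (fun s => c.eta s i) t = η' i - η i := fun i => by
    have h2 : HasDerivAt (fun s : ℝ => η i + s * (η' i - η i)) (η' i - η i) t := by
      simpa using ((hasDerivAt_id t).mul_const (η' i - η i)).const_add (η i)
    exact h2.deriv
  calc _ ≤ ∑ _i : Fin (n + 1), ((2 * Real.pi * ρ₁ * ρ₂ * radialSpeed n) ^ 2
        + Real.exp (4 * Real.pi ^ 2 * ρ₂ ^ 2) / (4 * Real.pi ^ 2 * ρ₁ ^ 2) * M ^ 2) := by
        refine Finset.sum_le_sum fun i _ => ?_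
        rw [hη]
        have hr1 : γ t i ^ 2 ≤ 1 := by
          rw [← hγs t]
          exact Finset.single_le_sum (f := fun j => γ t j ^ 2) (fun j _ => sq_nonneg _)
            (Finset.mem_univ i)
        refine add_le_add ?_ ?_
        · have h1 : 4 * Real.pi ^ 2 * ρ₂ ^ 2 * γ t i ^ 2
              ≤ Real.exp (4 * Real.pi ^ 2 * ρ₂ ^ 2 * γ t i ^ 2) := by
            linarith [Real.add_one_le_exp (4 * Real.pi ^ 2 * ρ₂ ^ 2 * γ t i ^ 2)]
          have h2 : 16 * Real.pi ^ 4 * ρ₁ ^ 2 * ρ₂ ^ 4 * γ t i ^ 2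
              / Real.exp (4 * Real.pi ^ 2 * ρ₂ ^ 2 * γ t i ^ 2) ≤ (2 * Real.pi * ρ₁ * ρ₂) ^ 2 := by
            rw [div_le_iff₀ (Real.exp_pos _)]
            calc _ = (2 * Real.pi * ρ₁ * ρ₂) ^ 2 * (4 * Real.pi ^ 2 * ρ₂ ^ 2 * γ t i ^ 2) := by ring
              _ ≤ _ := mul_le_mul_of_nonneg_left h1 (sq_nonneg _)
          rw [mul_pow _ (radialSpeed n)]
          refine mul_le_mul h2 ?_ (sq_nonneg _) (sq_nonneg _)
          rw [← sq_abs (deriv _ _)]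
          exact pow_le_pow_left₀ (abs_nonneg _) (hγd t i) 2
        · refine mul_le_mul ?_ ?_ (sq_nonneg _) (by positivity)
          · refine div_le_div_of_nonneg_right (Real.exp_le_exp.2 ?_) (by positivity)
            exact mul_le_of_le_one_right (by positivity) hr1
          · rw [← sq_abs (η' i - η i)]
            exact pow_le_pow_left₀ (abs_nonneg _) (hM i) 2
    _ = _ := by
        rw [Finset.sum_const, Finset.card_univ, Fintype.card_fin, nsmul_eq_mul, Nat.cast_add,
          Nat.cast_one]

theorem RadiallyClose.degenerateDist_le {n : ℕ} {s ρ₁ ρ₂ : ℝ} (hρ₁ : 0 < ρ₁) (hρ₂ : 0 < ρ₂)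
    {p q : H n} (h : RadiallyClose s p q) : H.degenerateDist ρ₁ ρ₂ p q
      ≤ ENNReal.ofReal ((n + 1) * (2 * Real.pi * ρ₁ * ρ₂ * radialSpeed n)) := by
  obtain ⟨r, r', η, hr, hr', h0, h0', rfl, rfl, -⟩ := h
  refine (degenerateDist_polar_le hρ₁ hρ₂ r r' η η hr hr' h0 h0' (M := 0) (by simp)).trans
    (ENNReal.ofReal_le_ofReal ?_)
  have hπ := Real.pi_pos
  have hK := radialSpeed_pos n
  rw [Real.sqrt_le_left (by positivity), mul_pow ((n : ℝ) + 1)]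
  simp only [ne_eq, OfNat.ofNat_ne_zero, not_false_eq_true, zero_pow, mul_zero, add_zero]
  refine mul_le_mul_of_nonneg_right ?_ (sq_nonneg _)
  have : (0 : ℝ) ≤ n := n.cast_nonneg
  nlinarith

theorem diameter_degenerateDist_ne_top {n : ℕ} {ρ₁ ρ₂ : ℝ} (hρ₁ : 0 < ρ₁) (hρ₂ : 0 < ρ₂)
    (A : Set (H n)) : diameter (H.degenerateDist ρ₁ ρ₂) A ≠ ⊤ := by
  refine ne_top_of_le_ne_top (b := ENNReal.ofReal (Real.sqrt ((n + 1)
    * ((2 * Real.pi * ρ₁ * ρ₂ * radialSpeed n) ^ 2 + Real.exp (4 * Real.pi ^ 2 * ρ₂ ^ 2)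
      / (4 * Real.pi ^ 2 * ρ₁ ^ 2) * 2 ^ 2)))) ENNReal.ofReal_ne_top
    (iSup₂_le fun p _ => iSup₂_le fun q _ => ?_)
  · obtain ⟨z, rfl⟩ : ∃ z, H.mk z = p := Quotient.exists_rep p
    obtain ⟨w, rfl⟩ : ∃ w, H.mk w = q := Quotient.exists_rep q
    obtain ⟨r, η, hr, h0, hη, rfl⟩ := exists_polar z
    obtain ⟨r', η', hr', h0', hη', rfl⟩ := exists_polar w
    refine degenerateDist_polar_le hρ₁ hρ₂ r r' η η' hr hr' h0 h0' fun i => ?_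
    linarith [abs_sub (η' i) (η i), hη i, hη' i]

/-- Radial terms are dropped and the exponentials bounded below by 1. Then (a-b)² ≤ 2(a²+b²) applies
to the velocities of η₀ and ηₙ; the factor 4π leaves room that avoids a √2. -/
theorem ofReal_le_length {n : ℕ} (hn : 1 ≤ n) {ρ₁ ρ₂ : ℝ} (hρ₁ : 0 < ρ₁) (c : PolarCurve n) :
    ENNReal.ofReal (|(c.eta 1 0 - c.eta 1 (Fin.last n)) - (c.eta 0 0 - c.eta 0 (Fin.last n))|
      / (4 * Real.pi * ρ₁)) ≤ c.length ρ₁ ρ₂ := by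
  have hπ := Real.pi_pos
  let g : ℝ → ℝ := fun t => (c.eta t 0 - c.eta t (Fin.last n)) / (4 * Real.pi * ρ₁)
  have hg : ContDiff ℝ 1 g :=
    ((contDiff_pi.1 c.contDiff_eta 0).sub (contDiff_pi.1 c.contDiff_eta (Fin.last n))).div_const _
  have h := enorm_sub_le_lintegral_deriv_of_contDiffOn_Icc (f := g) hg.contDiffOn zero_le_one
  rw [← ofReal_norm, Real.norm_eq_abs, ← sub_div, abs_div,
    abs_of_pos (by positivity : 0 < 4 * Real.pi * ρ₁)] at h
  refine h.trans (MeasureTheory.setLIntegral_mono' measurableSet_Icc fun t _ => ?_)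
  rw [← ofReal_norm, Real.norm_eq_abs]
  refine ENNReal.ofReal_le_ofReal (Real.abs_le_sqrt ?_)
  have hd : ∀ i, DifferentiableAt ℝ (fun s => c.eta s i) t := fun i =>
    (contDiff_pi.1 c.contDiff_eta i).differentiable one_ne_zero t
  have hgd : deriv g t = (deriv (fun s => c.eta s 0) t
      - deriv (fun s => c.eta s (Fin.last n)) t) / (4 * Real.pi * ρ₁) :=
    (((hd 0).hasDerivAt.sub (hd (Fin.last n)).hasDerivAt).div_const _).deriv
  have hne : (0 : Fin (n + 1)) ≠ Fin.last n := by
    rw [Ne, Fin.ext_iff]; simp; omega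
  have hterm : ∀ i, deriv (fun s => c.eta s i) t ^ 2 / (4 * Real.pi ^ 2 * ρ₁ ^ 2)
      ≤ 16 * Real.pi ^ 4 * ρ₁ ^ 2 * ρ₂ ^ 4 * c.r t i ^ 2
        / Real.exp (4 * Real.pi ^ 2 * ρ₂ ^ 2 * c.r t i ^ 2) * deriv (fun s => c.r s i) t ^ 2
      + Real.exp (4 * Real.pi ^ 2 * ρ₂ ^ 2 * c.r t i ^ 2) / (4 * Real.pi ^ 2 * ρ₁ ^ 2)
        * deriv (fun s => c.eta s i) t ^ 2 := fun i => by
    refine le_trans ?_ (le_add_of_nonneg_left (by positivity))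
    rw [div_mul_eq_mul_div]
    refine div_le_div_of_nonneg_right ?_ (by positivity)
    exact le_mul_of_one_le_left (sq_nonneg _) (Real.one_le_exp (by positivity))
  calc deriv g t ^ 2
      ≤ ∑ i ∈ {0, Fin.last n}, deriv (fun s => c.eta s i) t ^ 2 / (4 * Real.pi ^ 2 * ρ₁ ^ 2) := by
        rw [Finset.sum_pair hne, hgd, ← add_div, div_pow,
          div_le_div_iff₀ (by positivity) (by positivity)]
        have h3 : 0 ≤ Real.pi ^ 2 * ρ₁ ^ 2 := by positivity
        nlinarith [mul_nonneg h3 (sq_nonneg (deriv (fun s => c.eta s 0) t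
          + deriv (fun s => c.eta s (Fin.last n)) t)), mul_nonneg h3 (sq_nonneg
          (deriv (fun s => c.eta s 0) t)), mul_nonneg h3 (sq_nonneg
          (deriv (fun s => c.eta s (Fin.last n)) t))]
    _ ≤ ∑ i, deriv (fun s => c.eta s i) t ^ 2 / (4 * Real.pi ^ 2 * ρ₁ ^ 2) :=
        Finset.sum_le_sum_of_subset_of_nonneg (Finset.subset_univ _)
          fun _ _ _ => by positivity
    _ ≤ _ := Finset.sum_le_sum fun i _ => hterm i

/-- Lifts of a point of the image differ by `NDual n`, whose coordinate differences are killed by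
n+1. So (n+1)(η₀ - ηₙ) depends only on the point; the sign changes because π₂ uses -η. -/
theorem eta_eq_of_mk_eq {n : ℕ} (hn : 1 ≤ n) {k₁ k₂ : ℝ} (h : IsAdmissible n k₁ k₂)
    {p : XTilde n k₁ k₂} (c : PolarCurve n) (t : unitInterval)
    (hc : H.mk (c.point t) = piTwo h (X.mk p)) :
    (n + 1) • ((c.eta t 0 : UnitAddCircle) - (c.eta t (Fin.last n) : UnitAddCircle))
      = (n + 1) • (p.1.eta (Fin.last n) - p.1.eta 0) := by
  rw [piTwo_mk] at hc
  obtain ⟨u, hu, hz⟩ := Quotient.exact hc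
  have key : ∀ i, (c.eta t i : UnitAddCircle) = -p.1.eta i - u i := fun i => by
    have := hz i
    simp only [piTwoVec_apply, c.point_eq] at this
    rw [mul_left_comm, ← Circle.coe_mul, ← AddCircle.toCircle_add] at this
    rw [(eq_of_mul_toCircle_eq (Real.sqrt_pos.2 (weight_pos hn h p.2 i))
      (c.r_nonneg t t.2 i) this).2]
    abel
  have h1 := smul_eq_sum_of_mem_NDual hu 0
  rw [← smul_eq_sum_of_mem_NDual hu (Fin.last n)] at h1
  have h2 : -p.1.eta 0 - u 0 - (-p.1.eta (Fin.last n) - u (Fin.last n))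
      = (p.1.eta (Fin.last n) - p.1.eta 0) + (u (Fin.last n) - u 0) := by abel
  rw [key, key, h2, smul_add, smul_sub (n + 1) (u (Fin.last n)), h1, sub_self, add_zero]

theorem le_diameter_range {n : ℕ} (hn : 1 ≤ n) {k₁ k₂ : ℝ} (h : IsAdmissible n k₁ k₂) (ρ₂ : ℝ) :
    ENNReal.ofReal (1 / (8 * Real.pi * (n + 1) * rho₁ k₁))
      ≤ diameter (H.degenerateDist (rho₁ k₁) ρ₂) (Set.range (piTwo h)) := by
  have hπ := Real.pi_pos
  have hρ := h.rho₂_pos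
  have hρ₁ := h.rho₁_pos
  have hn' : (0 : ℝ) < n + 1 := by positivity
  have hne : (0 : Fin (n + 1)) ≠ Fin.last n := by
    rw [Ne, Fin.ext_iff]; simp; omega
  obtain ⟨s, -, -, hexp⟩ := exists_segment_weights
    (L := 4 * Real.pi ^ 2 * rho₂ n k₁ k₂ ^ 2) (by positivity) h.log_lt
    (Pi.single 0 1) (fun i => by by_cases hi : i = 0 <;> simp [hi])
    ⟨Fin.last n, Pi.single_eq_of_ne hne.symm _⟩
  have ha : ∑ i, ((1 - s) * (Pi.single 0 1 : Fin (n + 1) → ℝ) i + s / (n + 1)) = 1 := by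
    rw [Finset.sum_add_distrib, ← Finset.mul_sum]
    simp
    field_simp
    ring
  -- The points p and q have equal weights. With this σ their values of (n+1)(η₀ - ηₙ) differ by
  -- (n+1)·2σ = 1/2, so along any joining curve (n+1)(η₀ - ηₙ) changes by a half-integer.
  let σ : UnitAddCircle := ((1 / (4 * (n + 1)) : ℝ) : UnitAddCircle)
  obtain ⟨p, hp, -⟩ := exists_mem_XTilde h _ 0 (by simp) ha hexp
  obtain ⟨q, hq, -⟩ := exists_mem_XTilde h _ (Pi.single (Fin.last n) σ - Pi.single 0 σ)
    (by simp [Finset.sum_sub_distrib]) ha hexp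
  refine le_trans ?_ (le_iSup₂_of_le (piTwo h (X.mk p)) ⟨_, rfl⟩
    (le_iSup₂_of_le (piTwo h (X.mk q)) ⟨_, rfl⟩ le_rfl))
  refine le_iInf fun c => le_iInf fun hc0 => le_iInf fun hc1 =>
    le_trans (ENNReal.ofReal_le_ofReal ?_) (ofReal_le_length hn hρ₁ c)
  have e0 := eta_eq_of_mk_eq hn h c 0 hc0
  have e1 := eta_eq_of_mk_eq hn h c 1 hc1
  rw [hp] at e0
  rw [hq] at e1
  simp only [Pi.sub_apply, Pi.single_eq_same, Pi.single_eq_of_ne hne, Pi.single_eq_of_ne hne.symm,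
    Pi.zero_apply, sub_zero, zero_sub, sub_neg_eq_add, smul_zero, Set.Icc.coe_zero,
    Set.Icc.coe_one] at e0 e1
  set x := (c.eta 1 0 - c.eta 1 (Fin.last n)) - (c.eta 0 0 - c.eta 0 (Fin.last n)) with hx
  have hcoe : (((n + 1 : ℕ) * x - 1 / 2 : ℝ) : UnitAddCircle) = 0 := by
    have e2 : (((n + 1 : ℕ) * x : ℝ) : UnitAddCircle) = (n + 1) • (σ + σ) := by
      rw [← nsmul_eq_mul, AddCircle.coe_nsmul, hx, AddCircle.coe_sub, AddCircle.coe_sub,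
        AddCircle.coe_sub, smul_sub, e0, e1, sub_zero]
    rw [AddCircle.coe_sub, e2, ← AddCircle.coe_add, ← AddCircle.coe_nsmul, ← AddCircle.coe_sub]
    have : (n + 1) • (1 / (4 * ((n : ℝ) + 1)) + 1 / (4 * ((n : ℝ) + 1))) - 1 / 2 = 0 := by
      rw [nsmul_eq_mul]
      push_cast
      field_simp
      norm_num
    rw [this, AddCircle.coe_zero]
  obtain ⟨m, hm⟩ := (AddCircle.coe_eq_zero_iff (1 : ℝ)).1 hcoe
  have hm' : ((n : ℝ) + 1) * x = m + 1 / 2 := by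
    have : (m : ℝ) = (n + 1 : ℕ) * x - 1 / 2 := by simpa using hm
    push_cast at this
    linarith
  have hhalf : 1 / 2 ≤ ((n : ℝ) + 1) * |x| := by
    have : ((n : ℝ) + 1) * |x| = |(m : ℝ) + 1 / 2| := by rw [← hm', abs_mul, abs_of_pos hn']
    rw [this, le_abs]
    rcases le_or_gt 0 m with hm0 | hm0
    · left
      have : (0 : ℝ) ≤ m := by exact_mod_cast hm0
      linarith
    · right
      have : (m : ℝ) ≤ -1 := by exact_mod_cast Int.le_sub_one_of_lt hm0
      linarith
  rw [div_le_div_iff₀ (by positivity) (by positivity)]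
  have := mul_le_mul_of_nonneg_left hhalf (by positivity : 0 ≤ 8 * Real.pi * rho₁ k₁)
  linarith

/-! ### Combining the estimates -/

theorem normalizedHausdorff_le {α : Type*} {d : α → α → ℝ≥0∞} {A B : Set α} {x y : ℝ}
    (hy : 0 < y) (hh : hausdorff d A B ≤ ENNReal.ofReal x)
    (hd : ENNReal.ofReal y ≤ diameter d A) :
    normalizedHausdorff d A B ≤ ENNReal.ofReal (2 * x / y) := by
  rw [ENNReal.ofReal_div_of_pos hy, ENNReal.ofReal_mul zero_le_two, ENNReal.ofReal_ofNat]
  exact ENNReal.div_le_div (mul_le_mul_right hh 2) (hd.trans le_self_add)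

theorem exists_arccos_lt {ε : ℝ} (hε : 0 < ε) (n : ℕ) : ∃ R : ℝ, 1 ≤ R ∧ ∀ ρ, R < ρ →
    Real.arccos (Real.sqrt (1 - (n + 1) * Real.log (n + 1) / (4 * Real.pi ^ 2 * ρ ^ 2))) < ε := by
  have hπ := Real.pi_pos
  have h1 : Filter.Tendsto (fun ρ : ℝ => (n + 1) * Real.log (n + 1) / (4 * Real.pi ^ 2 * ρ ^ 2))
      Filter.atTop (nhds 0) :=
    Filter.Tendsto.const_div_atTop ((Filter.tendsto_pow_atTop two_ne_zero).const_mul_atTop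
      (by positivity)) _
  have h2 : Continuous fun s : ℝ => Real.arccos (Real.sqrt (1 - s)) :=
    Real.continuous_arccos.comp (by fun_prop)
  have h3 := (h2.tendsto 0).comp h1
  simp only [sub_zero, Real.sqrt_one, Real.arccos_one] at h3
  obtain ⟨R, hR⟩ := Filter.eventually_atTop.1 (h3.eventually_lt_const hε)
  exact ⟨max 1 R, le_max_left _ _, fun ρ hρ => hR ρ ((le_max_right _ _).trans hρ.le)⟩

end SelfDual

theorem mainTheorem5 (n : ℕ) (hn : 1 ≤ n) (ε : ℝ) (hε : 0 < ε) :
    ∃ R : ℝ, 0 < R ∧ ∃ c : ℝ, 0 < c ∧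
      ∀ (k₁ k₂ : ℝ) (h : SelfDual.IsAdmissible n k₁ k₂),
        R < SelfDual.rho₂ n k₁ k₂ → SelfDual.rho₁ k₁ * SelfDual.rho₂ n k₁ k₂ < c →
          (∀ p ∈ Set.range (SelfDual.piTwo h),
            SelfDual.diameter (SelfDual.X.distIn (SelfDual.piTwo h ⁻¹' {p}))
              (SelfDual.piTwo h ⁻¹' {p}) ≤ ENNReal.ofReal ε) ∧
          SelfDual.gromovHausdorff (SelfDual.X.dist (n := n) (k₁ := k₁) (k₂ := k₂))
            (fun p q : Set.range (SelfDual.piTwo h) => SelfDual.fibreDist h p.1 q.1)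
              < ENNReal.ofReal ε ∧
          SelfDual.hausdorff SelfDual.H.fubiniStudy (Set.range (SelfDual.piTwo h))
            (SelfDual.H.divisor n) < ENNReal.ofReal ε ∧
          (SelfDual.diameter
              (SelfDual.H.degenerateDist (SelfDual.rho₁ k₁) (SelfDual.rho₂ n k₁ k₂))
              (Set.range (SelfDual.piTwo h)) ≠ ⊤ ∧
            SelfDual.diameter
              (SelfDual.H.degenerateDist (SelfDual.rho₁ k₁) (SelfDual.rho₂ n k₁ k₂))
              (SelfDual.H.divisor n) ≠ ⊤ ∧
            SelfDual.normalizedHausdorff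
              (SelfDual.H.degenerateDist (SelfDual.rho₁ k₁) (SelfDual.rho₂ n k₁ k₂))
              (Set.range (SelfDual.piTwo h)) (SelfDual.H.divisor n) < ENNReal.ofReal ε) := by
  have hπ := Real.pi_pos
  have hK := SelfDual.radialSpeed_pos n
  obtain ⟨R, hR1, hR⟩ := SelfDual.exists_arccos_lt hε n
  set C₁ : ℝ := 2 * Real.pi * (n + 1) ^ 2 with hC₁
  set C₂ : ℝ := 2 * ((n + 1) * (2 * Real.pi * SelfDual.radialSpeed n)) * (8 * Real.pi * (n + 1))
    with hC₂
  have hC₁0 : 0 < C₁ := by positivity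
  have hC₂0 : 0 < C₂ := by positivity
  -- The three bounds on ρ₁ρ₂ give ρ₁ < 1, then C₁ρ₁ ≤ ε for the fibres, then C₂ρ₁ρ₂ < ε for the
  -- normalized distance.
  refine ⟨R, by linarith, min 1 (min (ε / C₁) (ε / C₂)), by positivity,
    fun k₁ k₂ h hρR hc => ?_⟩
  have hρ₁ := h.rho₁_pos
  have hρ₂ := h.rho₂_pos
  have hρρ : 0 < SelfDual.rho₁ k₁ * SelfDual.rho₂ n k₁ k₂ := mul_pos hρ₁ hρ₂
  have hle : SelfDual.rho₁ k₁ ≤ SelfDual.rho₁ k₁ * SelfDual.rho₂ n k₁ k₂ :=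
    le_mul_of_one_le_right hρ₁.le (by linarith)
  have h1 : SelfDual.rho₁ k₁ < 1 := hle.trans_lt (hc.trans_le (min_le_left _ _))
  have h2 : C₁ * SelfDual.rho₁ k₁ ≤ ε := by
    have := hle.trans (hc.le.trans ((min_le_right _ _).trans (min_le_left _ _)))
    rwa [le_div_iff₀ hC₁0, mul_comm] at this
  have h3 : SelfDual.rho₁ k₁ * SelfDual.rho₂ n k₁ k₂ * C₂ < ε := by
    have := hc.trans_le ((min_le_right _ _).trans (min_le_right _ _))
    rwa [lt_div_iff₀ hC₂0] at this
  refine ⟨fun p _ => (SelfDual.diameter_fibre_le hn h p).trans (ENNReal.ofReal_le_ofReal h2),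
    ?_, ?_, SelfDual.diameter_degenerateDist_ne_top hρ₁ hρ₂ _,
    SelfDual.diameter_degenerateDist_ne_top hρ₁ hρ₂ _, ?_⟩
  · refine (SelfDual.gromovHausdorff_le hn h).trans_lt ?_
    refine (ENNReal.div_le_div_right (ENNReal.ofReal_le_ofReal h2) 2).trans_lt ?_
    exact ENNReal.half_lt_self (by simpa using hε) ENNReal.ofReal_ne_top
  · refine (SelfDual.hausdorff_le_of_radiallyClose hn h fun p q hpq =>
      hpq.fubiniStudy_le).trans_lt ?_
    exact (ENNReal.ofReal_lt_ofReal_iff hε).2 (hR _ hρR)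
  · refine (SelfDual.normalizedHausdorff_le (by positivity)
      (SelfDual.hausdorff_le_of_radiallyClose hn h fun p q hpq => hpq.degenerateDist_le hρ₁ hρ₂)
      (SelfDual.le_diameter_range hn h _)).trans_lt ((ENNReal.ofReal_lt_ofReal_iff hε).2 ?_)
    refine lt_of_le_of_lt ?_ h3
    -- Dividing O(ρ₁ρ₂) by a diameter of order at least 1/ρ₁ yields an extra factor ρ₁, which is
    -- only needed to be less than 1.
    calc _ = SelfDual.rho₁ k₁ * SelfDual.rho₂ n k₁ k₂ * C₂ * SelfDual.rho₁ k₁ := by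
          rw [div_div_eq_mul_div, div_one, hC₂]; ring
      _ ≤ _ := mul_le_of_le_one_right (by positivity) h1.le
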